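/- \textbf{Paths and boxes.} A path $\lambda$ of length $N$ is a word of length $N$ in the steps $U=(1,1)$ and $D=(1,-1)$, read as a lattice path starting at the origin; write $\lambda(x)$ for its height at abscissa $x$ and $N_D(\lambda)$ for its number of $D$'s. It is a ballot path if it never goes below $y=0$, and a Dyck path if moreover it ends on $y=0$. A box is a unit diamond with corners $(x\pm1,y),(x,y\pm1)$, where $x+y$ is odd; $(x,y)$ is its center. For paths $\lambda,\mu$ of length $N$ with $\mu$ weakly above $\lambda$, the (shifted) skew shape $\lambda/\mu$ is the set of boxes with center $(x,y)$ such that $0\le x\le N$ and $\lambda(x)<y<\mu(x)$; the boxes with $x=N$ are called anchor boxes. \textbf{Tiles.} A ballot tile of length $(2n,n')$ is a ribbon of $2n+n'+1$ boxes whose centers, read from left to right, form (up to translation) a ballot path from $(0,0)$ to $(2n+n',n')$; it is a Dyck tile if $n'=0$. A tiling of $\lambda/\mu$ by such tiles is cover-inclusive if each tile, translated downward by one box (that is, by $(0,-2)$ in the above coordinates), is either strictly below $\lambda$ or contained in another tile. \textbf{Dyck tilings.} For a Dyck path $\lambda$ let $$P^{\mathrm{Dyck}}_{\lambda,\ast}=\sum_{\mu}\sum_{T}q^{\mathrm{art}(T)},$$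 where $\mu$ runs over the Dyck paths of the same length weakly above $\lambda$, $T$ over the cover-inclusive tilings of $\lambda/\mu$ by Dyck tiles, and $\mathrm{art}(T)=\frac12(\#\text{boxes of }\lambda/\mu+\#\text{tiles of }T)$. \textbf{Ballot tilings of type BIII.} For a path $\lambda$ of length $N$ let $$P^{III}_{\lambda,\ast}=\sum_{\mu}\sum_{T}q^{\mathrm{art}(T)}t^{\mathrm{tiles}_2(T)},$$ where $\mu$ runs over all paths of length $N$ weakly above $\lambda$, and $T$ over the cover-inclusive tilings of $\lambda/\mu$ by ballot tiles such that the rightmost box of every tile of length $(2n,n')$ with $n'\ge1$ is an anchor box. Here $\mathrm{tiles}_2(T)$ is the number of tiles of $T$ (Dyck tiles included) whose rightmost box is an anchor box, and $\mathrm{art}(T)$ is the sum over the tiles of $T$ of their individual $\mathrm{art}$, where a tile of length $(2n,n')$ has $\mathrm{area}=2n+1$, $\mathrm{tiles}=1$, and $\mathrm{art}=(\mathrm{area}-\mathrm{tiles})/2=n$ if its rightmost box is an anchor box and $\mathrm{art}=(\mathrm{area}+\mathrm{tiles})/2=n+1$ otherwise. \textbf{Theorem.} Let $\lambda$ be any finite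 word in $U,D$ (in particular, any ballot path), and let $\widehat\lambda=U^{a}\lambda D^{b}$ be any Dyck path obtained from $\lambda$ by putting $a\ge0$ steps $U$ on its left and $b\ge0$ steps $D$ on its right (for a ballot path one may take $a=0$). Then $$P^{III}_{\lambda,\ast}=P^{\mathrm{Dyck}}_{\widehat\lambda,\ast}\cdot\prod_{i=1}^{N_D(\lambda)}\bigl(1+q^{i-1}t\bigr)$$ as an identity of polynomials in $q$ and $t$ (equivalently, for all elements $q,t$ of every commutative ring). -/

import Mathlib

open scoped BigOperators

/-!
# Dyck tilings and ballot tilings of type BIII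

A path is a word in the up step `U = (1, 1)` and the down step `D = (1, -1)`, read from the
origin.  Boxes are the unit diamonds with corners `(x ± 1, y)`, `(x, y ± 1)`; a box is recorded
by its center `(x, y)`, where `x + y` is odd (the corners of the boxes are the lattice points
that paths can visit, for which `x + y` is even).
-/

namespace BallotTiling

/-- The height of the lattice point of abscissa `i` on the path `p`. -/
def height (p : List DyckStep) (i : ℕ) : ℤ :=
  ((p.take i).count DyckStep.U : ℤ) - ((p.take i).count DyckStep.D : ℤ)

/-- A ballot path: it never goes below the horizontal line `y = 0`. -/
def IsBallotPath (p : List DyckStep) : Prop := ∀ i, 0 ≤ height p i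

/-- A Dyck path: a ballot path which ends on the line `y = 0`. -/
def IsDyckPath (p : List DyckStep) : Prop := ∃ w : DyckWord, w.toList = p

/-- `LiesAbove mu lam`: the paths have the same length and `mu` is weakly above `lam`, i.e. the
skew shape with lower path `lam` and upper path `mu` exists. -/
def LiesAbove (mu lam : List DyckStep) : Prop :=
  mu.length = lam.length ∧ ∀ i, height lam i ≤ height mu i

/-- The (shifted) skew shape between the lower path `lam` and the upper path `mu` of length `N`,
as the finite set of the centers of its boxes.  The boxes with center on the line `x = N` are
the anchor boxes; there are none if both paths have the same end point, in particular if both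
are Dyck paths.  (A path of length `N` stays in the strip `-N ≤ y ≤ N`.) -/
noncomputable def skewShape (lam mu : List DyckStep) : Finset (ℕ × ℤ) :=
  (Finset.range (lam.length + 1) ×ˢ Finset.Icc (-(lam.length : ℤ)) (lam.length : ℤ)).filter
    fun b => Odd ((b.1 : ℤ) + b.2) ∧ height lam b.1 < b.2 ∧ b.2 < height mu b.1

/-- A ribbon whose box centers form a path: `(col, row)` is the center of its leftmost box, and
`word` is the path from there through the centers of the successive boxes. -/
structure Tile where
  col : ℕ
  row : ℤ
  word : List DyckStep

namespace Tile

/-- The centers of the boxes of a tile. -/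
def boxes (B : Tile) : Finset (ℕ × ℤ) :=
  (Finset.range (B.word.length + 1)).image fun i => (B.col + i, B.row + height B.word i)

/-- The boxes of a tile translated downward by one box. -/
def shiftDown (B : Tile) : Finset (ℕ × ℤ) := B.boxes.image fun b => (b.1, b.2 - 2)

/-- The abscissa of the center of the rightmost box of a tile. -/
def lastCol (B : Tile) : ℕ := B.col + B.word.length

/-- A tile whose word is a ballot path from `(0, 0)` to `(2n + n', n')` has length `(2n, n')`;
this is the number `n`, and the number `n'` is the end height of the word. -/
def halfLength (B : Tile) : ℕ := B.word.count DyckStep.D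

/-- A Dyck tile: the centers of the boxes form a Dyck path. -/
def IsDyck (B : Tile) : Prop := IsDyckPath B.word

/-- A ballot tile allowed in a ballot tiling of a shifted skew shape of paths of length `N`:
the centers of the boxes form a ballot path, say of length `(2n, n')`, and if `n' ≥ 1` then the
rightmost box is on an anchor box. -/
def IsBallot (N : ℕ) (B : Tile) : Prop :=
  IsBallotPath B.word ∧ (1 ≤ height B.word B.word.length → B.lastCol = N)

/-- The type BIII statistic `area` of a ballot tile of length `(2n, n')`. -/
def area (B : Tile) : ℕ := 2 * B.halfLength + 1

/-- The type BIII statistic `tiles` of a ballot tile. -/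
def tiles (_B : Tile) : ℕ := 1

/-- The type BIII statistic `art` of a ballot tile; it depends on whether the rightmost box of
the tile is on an anchor box. -/
def art (N : ℕ) (B : Tile) : ℕ :=
  if B.lastCol = N then (B.area - B.tiles) / 2 else (B.area + B.tiles) / 2

end Tile

/-- `T` is a cover-inclusive tiling of the skew shape between `lam` and `mu` by tiles satisfying
`P`: the box sets of the tiles are pairwise disjoint with union the shape, and each tile, when
translated downward by one box, is either strictly below `lam` or contained in another tile. -/
structure IsCoverInclusiveTiling (P : Tile → Prop) (lam mu : List DyckStep)
    (T : Finset Tile) : Prop where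
  tile : ∀ B ∈ T, P B
  disjoint : ∀ B ∈ T, ∀ C ∈ T, B ≠ C → Disjoint B.boxes C.boxes
  cover : T.biUnion Tile.boxes = skewShape lam mu
  coverInclusive : ∀ B ∈ T,
    (∀ b ∈ B.shiftDown, b.2 < height lam b.1) ∨ ∃ C ∈ T, C ≠ B ∧ B.shiftDown ⊆ C.boxes

lemma finite_paths (N : ℕ) : {p : List DyckStep | p.length ≤ N}.Finite := by
  have : Finite DyckStep :=
    Finite.of_surjective (fun b : Bool => if b then DyckStep.U else DyckStep.D)
      (fun s => by cases s; exacts [⟨true, rfl⟩, ⟨false, rfl⟩])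
  exact List.finite_length_le DyckStep N

lemma finite_tiles (lam mu : List DyckStep) :
    {B : Tile | B.boxes ⊆ skewShape lam mu}.Finite := by
  refine (((Set.finite_Iic lam.length).prod
    ((Set.finite_Icc (-(lam.length : ℤ)) lam.length).prod
      (finite_paths lam.length))).image (fun z => Tile.mk z.1 z.2.1 z.2.2)).subset ?_
  intro B hB
  have h0 : (B.col + 0, B.row + height B.word 0) ∈ skewShape lam mu :=
    hB (Finset.mem_image.2 ⟨0, by simp, rfl⟩)
  have h1 : (B.col + B.word.length, B.row + height B.word B.word.length) ∈ skewShape lam mu :=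
    hB (Finset.mem_image.2 ⟨B.word.length, by simp, rfl⟩)
  simp only [skewShape, Finset.mem_filter, Finset.mem_product, Finset.mem_range,
    Finset.mem_Icc] at h0 h1
  have hz : height B.word 0 = 0 := by simp [height]
  rw [hz] at h0
  refine ⟨(B.col, B.row, B.word), ⟨?_, ⟨?_, ?_⟩, ?_⟩, rfl⟩ <;>
    simp only [Set.mem_Iic, Set.mem_ofPred_eq] <;> omega

lemma finite_tilings (P : Tile → Prop) (lam mu : List DyckStep) :
    {T : Finset Tile | IsCoverInclusiveTiling P lam mu T}.Finite := by
  classical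
  refine ((finite_tiles lam mu).toFinset.powerset.finite_toSet).subset ?_
  intro T hT
  simp only [Finset.coe_powerset, Set.mem_preimage, Set.mem_powerset_iff]
  intro B hB
  simp only [Set.Finite.coe_toFinset, Set.mem_ofPred_eq]
  rw [← hT.cover]
  exact Finset.subset_biUnion_of_mem _ hB

lemma finite_upper (Q : List DyckStep → Prop) (lam : List DyckStep) :
    {mu : List DyckStep | Q mu ∧ LiesAbove mu lam}.Finite :=
  (finite_paths lam.length).subset fun _ h => h.2.1.le

/-- The set `𝓓(lam/mu)` of cover-inclusive Dyck tilings of the skew shape `lam/mu`. -/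
noncomputable def dyckTilings (lam mu : List DyckStep) : Finset (Finset Tile) :=
  (finite_tilings Tile.IsDyck lam mu).toFinset

/-- The set `𝓑(lam/mu)` of cover-inclusive ballot tilings of type BIII of the shifted skew
shape `lam/mu`. -/
noncomputable def ballotTilings (lam mu : List DyckStep) : Finset (Finset Tile) :=
  (finite_tilings (Tile.IsBallot lam.length) lam mu).toFinset

/-- The Dyck paths `mu` for which the skew shape `lam/mu` exists. -/
noncomputable def upperDyckPaths (lam : List DyckStep) : Finset (List DyckStep) :=
  (finite_upper IsDyckPath lam).toFinset

/-- The paths `mu` for which the shifted skew shape `lam/mu` exists. -/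
noncomputable def upperPaths (lam : List DyckStep) : Finset (List DyckStep) :=
  (finite_upper (fun _ => True) lam).toFinset

/-- The statistic `art = (area + tiles) / 2` of a Dyck tiling `T` of `lam/mu`, where `area` is
the number of boxes of `lam/mu` and `tiles` is the number of tiles of `T`. -/
noncomputable def dyckArt (lam mu : List DyckStep) (T : Finset Tile) : ℕ :=
  ((skewShape lam mu).card + T.card) / 2

/-- The type BIII statistic `art` of a ballot tiling: the sum of `art` over its tiles. -/
def ballotArt (N : ℕ) (T : Finset Tile) : ℕ := ∑ B ∈ T, B.art N

/-- The statistic `tiles₂` of a ballot tiling: the number of tiles (Dyck tiles included) whose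
rightmost box is on an anchor box. -/
def tilesTwo (N : ℕ) (T : Finset Tile) : ℕ := (T.filter fun B => B.lastCol = N).card

/-- The generating function `∑ q ^ art` of the cover-inclusive Dyck tilings with fixed lower
path `lam`. -/
noncomputable def genDyck {R : Type*} [CommRing R] (q : R) (lam : List DyckStep) : R :=
  ∑ mu ∈ upperDyckPaths lam, ∑ T ∈ dyckTilings lam mu, q ^ dyckArt lam mu T

/-- The generating function `∑ q ^ art * t ^ tiles₂` of the type BIII ballot tilings of
`lam/mu`. -/
noncomputable def genBIIIPair {R : Type*} [CommRing R] (q t : R) (lam mu : List DyckStep) : R :=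
  ∑ T ∈ ballotTilings lam mu, q ^ ballotArt lam.length T * t ^ tilesTwo lam.length T

/-- The generating function of the type BIII ballot tilings with fixed lower path `lam`. -/
noncomputable def genBIII {R : Type*} [CommRing R] (q t : R) (lam : List DyckStep) : R :=
  ∑ mu ∈ upperPaths lam, genBIIIPair q t lam mu

/-- The path obtained from `lam` by putting `a` up steps on its left and `b` down steps on its
right. -/
def extend (a b : ℕ) (lam : List DyckStep) : List DyckStep :=
  List.replicate a DyckStep.U ++ lam ++ List.replicate b DyckStep.D

/-- Every path can be extended to a Dyck path in this way. -/
lemma exists_isDyckPath_extend (lam : List DyckStep) : ∃ a b, IsDyckPath (extend a b lam) := by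
  refine ⟨lam.count DyckStep.D, lam.count DyckStep.U, ⟨extend _ _ lam, ?_, ?_⟩, rfl⟩
  · simp [extend, List.count_append, List.count_replicate]
  · intro i
    simp only [extend, List.take_append, List.count_append, List.take_replicate,
      List.count_replicate, List.length_append, List.length_replicate]
    have h1 := ((List.take_sublist (i - lam.count DyckStep.D) lam).count_le DyckStep.D)
    have h2 : (lam.take (i - lam.count DyckStep.D)).count DyckStep.D
        ≤ i - lam.count DyckStep.D :=
      List.count_le_length.trans (by simp)
    by_cases h : i - (lam.count DyckStep.D + lam.length) = 0
    · simp [h]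
      omega
    · rw [List.take_of_length_le (by omega)]
      simp
      omega

/-- A ballot path is extended to a Dyck path by down steps on its right only. -/
lemma IsBallotPath.exists_isDyckPath_extend {lam : List DyckStep} (h : IsBallotPath lam) :
    ∃ b, IsDyckPath (extend 0 b lam) := by
  have hn := h lam.length
  simp only [height, List.take_length] at hn
  refine ⟨lam.count DyckStep.U - lam.count DyckStep.D, ⟨extend _ _ lam, ?_, ?_⟩, rfl⟩
  · simp [extend, List.count_append, List.count_replicate]
    omega
  · intro i
    have hi := h i
    simp only [height] at hi
    simp only [extend, List.take_append, List.count_append, List.take_replicate,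
      List.count_replicate, List.length_append, List.length_replicate]
    by_cases hl : i - lam.length = 0
    · simp [hl]
      omega
    · rw [List.take_of_length_le (by omega)]
      simp
      omega

end BallotTiling

/-! Cover-inclusiveness forces every tile to run parallel to `lam`: all its boxes lie at the same
level above it (`level_const`). A tiling is therefore a set of triples (first column, last column,
level), a stacking, and the upper path is read off from the number of levels covered in each column
(`genBIII_eq_stackSum`). Cutting a stacking after column N turns the tiles that cross the cut into
anchored ballot tiles. Hence stackings grow one column at a time, and an extension is determined by
the number e of tiles that are prolonged and the number f of tiles that end in the new column
(`sum_stackings_succ`).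

The recursion closes once t is refined to variables x_a, where a is the starting height of an
anchored tile. Let F be the generating function of a path ending at height a. A down step replaces F
by (1 + x_{a-1}) times F with x_a set to x_{a-1} and then all variables multiplied by q
(`stackSum_down`). An up step applies a divided difference in x_a, with second point q x_{a+1}
(`stackSum_up`).

Both operations preserve the span of the products `stateProd`, which have n_0, n_1, ... factors
attached to the heights a, a-1, ..., the powers of q running on from one height to the next. A down
step merges n_0 and n_1 into n_0 + n_1 + 1; an up step splits n_0 into k and n_0 - k with
coefficient q^k (`stateProd_stateDown`, `divDiff_stateProd`). So F is a combination of such products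
whose coefficients involve q only (`stackSum_eq_stateSum`). When every x_a is t, each product
becomes (1 + t)(1 + qt)... with as many factors as the path has down steps, and the generating
function factors as c(lam) times this product, with c(lam) free of t (`stackSum_const`).

At t = 0 the product is 1 and anchored tiles are excluded, so for a Dyck path c is the Dyck tiling
generating function (`genDyck_eq_genBIII`). Finally, up steps on the left only append zeros to the
states, and down steps on the right change states without introducing coefficients, so c is the same
for `lam` and its extension (`stateSum_extend`). -/

namespace BallotTiling

/-! ### Divided differences, q-products and states -/

section Algebra

variable {A B : Type*} [CommRing A] [CommRing B]

/-- The product `(1 + z) (1 + q z) ⋯ (1 + q ^ (n - 1) z)`. -/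
def qProd (q z : A) (n : ℕ) : A := ∏ i ∈ Finset.range n, (1 + q ^ i * z)

lemma qProd_zero (q z : A) : qProd q z 0 = 1 := by simp [qProd]

lemma qProd_succ (q z : A) (n : ℕ) : qProd q z (n + 1) = qProd q z n * (1 + q ^ n * z) := by
  simp [qProd, Finset.prod_range_succ]

lemma qProd_add (q z : A) (m n : ℕ) :
    qProd q z (m + n) = qProd q z m * qProd q (q ^ m * z) n := by
  simp only [qProd, Finset.prod_range_add, pow_add]
  congr 1
  exact Finset.prod_congr rfl fun i _ => by ring

lemma qProd_succ' (q z : A) (n : ℕ) : qProd q z (n + 1) = (1 + z) * qProd q (q * z) n := by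
  rw [add_comm, qProd_add]
  simp [qProd]

lemma qProd_of_zero (q : A) (n : ℕ) : qProd q 0 n = 1 := by simp [qProd]

lemma prod_Icc_eq_qProd (q z : A) (n : ℕ) :
    ∏ i ∈ Finset.Icc 1 n, (1 + q ^ (i - 1) * z) = qProd q z n := by
  induction n with
  | zero => simp [qProd]
  | succ n ih =>
    rw [Finset.prod_Icc_succ_top (by omega), ih, qProd_succ, Nat.add_sub_cancel]

lemma map_qProd (f : A →+* B) (q z : A) (n : ℕ) : f (qProd q z n) = qProd (f q) (f z) n := by
  simp [qProd]

/-- The homogeneous sum `∑ x ^ i y ^ j` over `i + j = n - 1`. -/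
def homSum (x y : A) (n : ℕ) : A := ∑ a ∈ Finset.range n, x ^ a * y ^ (n - 1 - a)

lemma homSum_succ (x y : A) (n : ℕ) : homSum x y (n + 1) = y ^ n + x * homSum x y n := by
  simp only [homSum, Finset.sum_range_succ', Finset.mul_sum, add_comm]
  congr 1
  · simp
  · refine Finset.sum_congr rfl fun a ha => ?_
    rw [show n + 1 - 1 - (a + 1) = n - 1 - a by omega]
    ring

/-- The divided difference `((x + q) p(x) - (y + q) p(y)) / (x - y)` as a linear map. -/
noncomputable def divDiff (q x y : A) : Polynomial A →ₗ[A] A :=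
  (Polynomial.basisMonomials A).constr A fun m => homSum x y (m + 1) + q * homSum x y m

lemma divDiff_X_pow (q x y : A) (m : ℕ) :
    divDiff q x y (Polynomial.X ^ m) = homSum x y (m + 1) + q * homSum x y m := by
  have := (Polynomial.basisMonomials A).constr_basis A
    (fun m => homSum x y (m + 1) + q * homSum x y m) m
  rw [Polynomial.coe_basisMonomials] at this
  rwa [← Polynomial.monomial_one_right_eq_X_pow]

lemma divDiff_C_mul (q x y a : A) (p : Polynomial A) :
    divDiff q x y (Polynomial.C a * p) = a * divDiff q x y p := by
  rw [← Polynomial.smul_eq_C_mul, map_smul, smul_eq_mul]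

/-- Twisted Leibniz rule: (x+q) x p(x) - (y+q) y p(y) equals x ((x+q) p(x) - (y+q) p(y)) +
(x-y)(y+q) p(y). -/
lemma divDiff_X_mul (q x y : A) (p : Polynomial A) :
    divDiff q x y (Polynomial.X * p) = x * divDiff q x y p + (y + q) * p.eval y := by
  induction p using Polynomial.induction_on' with
  | add p r hp hr => simp only [mul_add, map_add, hp, hr, Polynomial.eval_add]; ring
  | monomial m a =>
    rw [← Polynomial.C_mul_X_pow_eq_monomial, mul_left_comm, ← pow_succ', divDiff_C_mul,
      divDiff_C_mul, divDiff_X_pow, divDiff_X_pow, homSum_succ x y (m + 1), homSum_succ x y m]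
    simp only [Polynomial.eval_mul, Polynomial.eval_C, Polynomial.eval_pow, Polynomial.eval_X]
    ring

/-- Going from n to n + 1 multiplies the argument by 1 + q^n X. By the Leibniz rule every old term
gains 1 + q^n x, which is the next factor of its second product, and the boundary term q^n (qz + q)
times `qProd q (q * z) n` is the new term k = n + 1. This is where the second point qz is needed. -/
lemma divDiff_qProd (q x z : A) (n : ℕ) :
    divDiff q x (q * z) (qProd (Polynomial.C q) Polynomial.X n) =
      ∑ k ∈ Finset.range (n + 1), q ^ k * (qProd q z k * qProd q (q ^ k * x) (n - k)) := by
  induction n with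
  | zero =>
    have := divDiff_X_pow q x (q * z) 0
    simp only [pow_zero] at this
    simp [qProd_zero, this, homSum]
  | succ n ih =>
    have h1 : qProd (Polynomial.C q) Polynomial.X (n + 1) =
        qProd (Polynomial.C q) Polynomial.X n +
          Polynomial.C (q ^ n) * (Polynomial.X * qProd (Polynomial.C q) Polynomial.X n) := by
      rw [qProd_succ, Polynomial.C_pow]; ring
    have h2 : (qProd (Polynomial.C q) Polynomial.X n).eval (q * z) = qProd q (q * z) n := by
      rw [← Polynomial.coe_evalRingHom, map_qProd]; simp
    rw [h1, map_add, divDiff_C_mul, divDiff_X_mul, h2, ih, Finset.sum_range_succ _ (n + 1),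
      Nat.sub_self, qProd_zero, qProd_succ']
    have h3 : ∀ k ∈ Finset.range (n + 1),
        q ^ k * (qProd q z k * qProd q (q ^ k * x) (n + 1 - k)) =
          (1 + q ^ n * x) * (q ^ k * (qProd q z k * qProd q (q ^ k * x) (n - k))) := by
      intro k hk
      obtain ⟨m, rfl⟩ : ∃ m, n = k + m := ⟨n - k, by have := Finset.mem_range.1 hk; omega⟩
      rw [show k + m + 1 - k = m + 1 by omega, show k + m - k = m by omega, qProd_succ]
      ring
    rw [Finset.sum_congr rfl h3, ← Finset.mul_sum]
    ring

/-- The effect of a down step on a state, i.e. on the list of the exponents at the current height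
and at the lower heights. -/
def stateDown : ℕ × List ℕ → ℕ × List ℕ
  -- A missing lower exponent counts as 0.
  | (n, []) => (n + 1, [])
  | (n, m :: s) => (n + m + 1, s)

/-- The state functional obtained from `g` by reading the first `N` steps of the path with
heights `h`. -/
def stateSum (h : ℕ → ℤ) (q : A) : ℕ → (ℕ × List ℕ → A) → A
  | 0, g => g (0, [])
  | N + 1, g =>
    if h (N + 1) < h N then stateSum h q N fun s => g (stateDown s)
    else stateSum h q N fun s =>
      ∑ k ∈ Finset.range (s.1 + 1), q ^ k * g (k, (s.1 - k) :: s.2)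

/-- Needed for f = `divDiff`, which is only linear over constants: it carries multiplication by
powers of the constant polynomial q to multiplication by powers of q. -/
lemma map_stateSum (h : ℕ → ℤ) (f : A →+ B) (p : A) (q : B)
    (hf : ∀ k a, f (p ^ k * a) = q ^ k * f a) (N : ℕ) (g : ℕ × List ℕ → A) :
    f (stateSum h p N g) = stateSum h q N fun s => f (g s) := by
  induction N generalizing g with
  | zero => rfl
  | succ N ih =>
    simp only [stateSum]
    split_ifs
    · exact ih _
    · simp only [ih, map_sum, hf]

lemma stateSum_mul_left (h : ℕ → ℤ) (q c : A) (N : ℕ) (g : ℕ × List ℕ → A) :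
    c * stateSum h q N g = stateSum h q N fun s => c * g s :=
  map_stateSum h (AddMonoidHom.mulLeft c) q q (fun k a => by simp; ring) N g

/-- The number of down steps between the abscissas `i` and `j`. -/
def downs (h : ℕ → ℤ) (i j : ℕ) : ℕ := ((Finset.Ico i j).filter fun x => h (x + 1) < h x).card

lemma downs_succ (h : ℕ → ℤ) {i j : ℕ} (hij : i ≤ j) :
    downs h i (j + 1) = downs h i j + if h (j + 1) < h j then 1 else 0 := by
  rw [downs, downs, ← Finset.insert_Ico_right_eq_Ico_add_one hij, Finset.filter_insert]
  split_ifs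
  · rw [Finset.card_insert_of_notMem (by simp)]
  · rfl

lemma downs_self (h : ℕ → ℤ) (i : ℕ) : downs h i i = 0 := by simp [downs]

/-- Only states whose total is the number of down steps are reached: a down step raises the total by
one and the splitting at an up step preserves it. -/
lemma stateSum_congr (h : ℕ → ℤ) (q : A) (N : ℕ) (g g' : ℕ × List ℕ → A)
    (hg : ∀ s, s.1 + s.2.sum = downs h 0 N → g s = g' s) :
    stateSum h q N g = stateSum h q N g' := by
  induction N generalizing g g' with
  | zero => exact hg _ (by simp [downs])
  | succ N ih =>
    have hN := downs_succ h (Nat.zero_le N)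
    simp only [stateSum]
    split_ifs with hd
    · refine ih _ _ fun s hs => hg _ ?_
      rw [hN, if_pos hd]
      rcases s with ⟨n, _ | ⟨m, s⟩⟩ <;> simp [stateDown] at hs ⊢ <;> omega
    · refine ih _ _ fun s hs => Finset.sum_congr rfl fun k hk => ?_
      rw [hg]
      rw [hN, if_neg hd]
      have := Finset.mem_range.1 hk
      simp at hs ⊢
      omega

/-- The product attached to a state: the exponents `s` are read from the height `a` downward. -/
def stateProd (q : A) (x : ℤ → A) : ℤ → ℕ → List ℕ → A
  | _, _, [] => 1
  | a, e, n :: s => qProd q (q ^ e * x a) n * stateProd q x (a - 1) (e + n) s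

lemma stateProd_congr (q : A) (x y : ℤ → A) (a : ℤ) (e : ℕ) (s : List ℕ)
    (hxy : ∀ b ≤ a, x b = y b) : stateProd q x a e s = stateProd q y a e s := by
  induction s generalizing a e with
  | nil => rfl
  | cons n s ih =>
    rw [stateProd, stateProd, hxy a le_rfl, ih _ _ fun b hb => hxy b (by omega)]

lemma map_stateProd (f : A →+* B) (q : A) (x : ℤ → A) (a : ℤ) (e : ℕ) (s : List ℕ) :
    f (stateProd q x a e s) = stateProd (f q) (fun b => f (x b)) a e s := by
  induction s generalizing a e with
  | nil => simp [stateProd]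
  | cons n s ih => simp [stateProd, map_qProd, ih]

lemma stateProd_mul (q : A) (x : ℤ → A) (a : ℤ) (e : ℕ) (s : List ℕ) :
    stateProd q (fun b => q * x b) a e s = stateProd q x a (e + 1) s := by
  induction s generalizing a e with
  | nil => rfl
  | cons n s ih =>
    rw [stateProd, stateProd, ih, show e + n + 1 = e + 1 + n by omega, pow_succ, mul_assoc]

/-- The offset e grows by the exponents already read, so with equal variables the factors
concatenate into one q-product. -/
lemma stateProd_const (q t : A) (a : ℤ) (e : ℕ) (s : List ℕ) :
    stateProd q (fun _ => t) a e s = qProd q (q ^ e * t) s.sum := by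
  induction s generalizing a e with
  | nil => simp [stateProd, qProd]
  | cons n s ih =>
    rw [stateProd, ih, List.sum_cons, qProd_add, pow_add]
    congr 2
    ring

/-- The n + m + 1 factors at height a - 1 are 1 + x_{a-1}, then n factors and then m factors, all
shifted by q. The n factors are those of height a with x_a set to x_{a-1}. -/
lemma stateProd_stateDown (q : A) (x : ℤ → A) (a : ℤ) (s : ℕ × List ℕ) :
    stateProd q x (a - 1) 0 ((stateDown s).1 :: (stateDown s).2) =
      (1 + x (a - 1)) *
        stateProd q (fun b => q * Function.update x a (x (a - 1)) b) a 0 (s.1 :: s.2) := by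
  rcases s with ⟨n, _ | ⟨m, s⟩⟩
  · simp [stateDown, stateProd, qProd_succ']
  · have h1 : ∀ e, stateProd q (fun b => q * Function.update x a (x (a - 1)) b) (a - 1 - 1) e s =
        stateProd q x (a - 1 - 1) (e + 1) s := by
      intro e
      rw [stateProd_mul]
      refine stateProd_congr _ _ _ _ _ _ fun b hb => Function.update_of_ne (by omega) _ _
    simp only [stateDown, stateProd, h1, Function.update_self,
      Function.update_of_ne (show a - 1 ≠ a by omega), pow_zero, one_mul, zero_add]
    rw [show n + m + 1 = (n + m) + 1 by rfl, qProd_succ', qProd_add]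
    ring

/-- Only the top factor contains X; the lower ones are constants that pass through the divided
difference, and splitting the top exponent does not change their offset. -/
lemma divDiff_stateProd (q : A) (x : ℤ → A) (a : ℤ) (s : ℕ × List ℕ) :
    divDiff q (x a) (q * x (a + 1)) (stateProd (Polynomial.C q)
        (Function.update (fun b => Polynomial.C (x b)) a Polynomial.X) a 0 (s.1 :: s.2)) =
      ∑ k ∈ Finset.range (s.1 + 1), q ^ k * stateProd q x (a + 1) 0 (k :: (s.1 - k) :: s.2) := by
  have h1 : stateProd (Polynomial.C q)
      (Function.update (fun b => Polynomial.C (x b)) a Polynomial.X) (a - 1) (0 + s.1) s.2 =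
      Polynomial.C (stateProd q x (a - 1) s.1 s.2) := by
    rw [map_stateProd, zero_add]
    exact stateProd_congr _ _ _ _ _ _ fun b hb => Function.update_of_ne (by omega) _ _
  rw [stateProd, h1, Function.update_self, pow_zero, one_mul,
    mul_comm (qProd _ _ _), divDiff_C_mul,
    divDiff_qProd, Finset.mul_sum]
  refine Finset.sum_congr rfl fun k hk => ?_
  have : k + (s.1 - k) = s.1 := by have := Finset.mem_range.1 hk; omega
  simp only [stateProd, pow_zero, one_mul, zero_add, add_sub_cancel_right, this]
  ring

end Algebra

/-! ### Stackings and their extension by one column -/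

section Stackings

/-- The column `x` is covered by a piece of `S` at level `k`.  Here `(i, j, k) ∈ S` stands for a
tile at level `k` which occupies the columns from `i` to `j`. -/
def Covers (S : Finset (ℕ × ℕ × ℕ)) (x k : ℕ) : Prop := ∃ i j, (i, j, k) ∈ S ∧ i ≤ x ∧ x ≤ j

/-- The combinatorial data of a cover-inclusive ballot tiling over the path with heights `h`,
restricted to the columns `0, …, N`: a tile `(i, j, k)` has the boxes with centers
`(x, h x + 1 + 2 k)` for `i ≤ x ≤ j`. -/
structure IsStacking (h : ℕ → ℤ) (N : ℕ) (S : Finset (ℕ × ℕ × ℕ)) : Prop where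
  le : ∀ i j k, (i, j, k) ∈ S → i ≤ j ∧ j ≤ N
  ballot : ∀ i j k, (i, j, k) ∈ S → ∀ x, i ≤ x → x ≤ j → h i ≤ h x
  closed : ∀ i j k, (i, j, k) ∈ S → j < N → h j = h i
  unique : ∀ i j i' j' k x, (i, j, k) ∈ S → (i', j', k) ∈ S → i ≤ x → x ≤ j → i' ≤ x → x ≤ j' →
    i = i' ∧ j = j'
  nested : ∀ i j k, (i, j, k + 1) ∈ S → ∃ i' j', (i', j', k) ∈ S ∧ i' ≤ i ∧ j ≤ j'
  -- The remaining fields say that the upper boundary is a path from the origin: over a down step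
  -- the covered depth stays or grows by one, over an up step it stays or drops by one.
  not_covers_zero : ∀ k, ¬ Covers S 0 k
  down : ∀ x k, x < N → h (x + 1) < h x → Covers S x k → Covers S (x + 1) k
  down' : ∀ x k, x < N → h (x + 1) < h x → Covers S (x + 1) (k + 1) → Covers S x k
  up : ∀ x k, x < N → h x < h (x + 1) → Covers S (x + 1) k → Covers S x k
  up' : ∀ x k, x < N → h x < h (x + 1) → Covers S x (k + 1) → Covers S (x + 1) k

lemma mem_iff_lt_card {A : Finset ℕ} (hA : ∀ k, k + 1 ∈ A → k ∈ A) (k : ℕ) :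
    k ∈ A ↔ k < A.card := by
  have hle : ∀ n m, m ≤ n → n ∈ A → m ∈ A := by
    intro n m hmn
    induction n, hmn using Nat.le_induction with
    | base => exact id
    | succ n _ ih => exact fun h => ih (hA n h)
  constructor
  · intro hk
    have : Finset.range (k + 1) ⊆ A := fun m hm =>
      hle k m (by have := Finset.mem_range.1 hm; omega) hk
    simpa using Finset.card_le_card this
  · intro hk
    by_contra hkA
    have : A ⊆ Finset.range k := fun m hm => by
      by_contra hmk
      exact hkA (hle m k (by simpa using hmk) hm)
    have := Finset.card_le_card this
    rw [Finset.card_range] at this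
    omega

/-- The number of tiles with last column `N`. -/
def depth (N : ℕ) (S : Finset (ℕ × ℕ × ℕ)) : ℕ := (S.filter fun τ => τ.2.1 = N).card

/-- The number of tiles with last column `N` which start below the height of `N`. -/
def lowDepth (h : ℕ → ℤ) (N : ℕ) (S : Finset (ℕ × ℕ × ℕ)) : ℕ :=
  (S.filter fun τ => τ.2.1 = N ∧ h τ.1 < h N).card

/-- The number of tiles with last column `N + 1` which start before it. -/
def keptDepth (N : ℕ) (S : Finset (ℕ × ℕ × ℕ)) : ℕ :=
  (S.filter fun τ => τ.2.1 = N + 1 ∧ τ.1 ≤ N).card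

variable {h : ℕ → ℤ} {N : ℕ} {S : Finset (ℕ × ℕ × ℕ)}

namespace IsStacking

/-- The tile below a tile ending at N also ends at N and starts neither further right nor higher. So
the levels of the selected tiles form an initial segment, which their number determines. -/
lemma lt_card_filter (hS : IsStacking h N S) (p : ℕ → Prop) [DecidablePred p]
    (hp : ∀ i i', i' ≤ i → h i' ≤ h i → p i → p i') (k : ℕ) :
    k < (S.filter fun τ => τ.2.1 = N ∧ p τ.1).card ↔ ∃ i, (i, N, k) ∈ S ∧ p i := by
  have hcard : ((S.filter fun τ => τ.2.1 = N ∧ p τ.1).image fun τ => τ.2.2).card =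
      (S.filter fun τ => τ.2.1 = N ∧ p τ.1).card := by
    refine Finset.card_image_of_injOn ?_
    rintro ⟨i, j, k⟩ h1 ⟨i', j', k'⟩ h2 (rfl : k = k')
    simp only [Finset.coe_filter, Set.mem_ofPred_eq] at h1 h2
    obtain ⟨h1, rfl, -⟩ := h1
    obtain ⟨h2, rfl, -⟩ := h2
    have := hS.unique i _ i' _ k _ h1 h2 (hS.le _ _ _ h1).1 le_rfl (hS.le _ _ _ h2).1 le_rfl
    rw [this.1]
  rw [← hcard, ← mem_iff_lt_card]
  · simp only [Finset.mem_image, Finset.mem_filter, Prod.exists]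
    constructor
    · rintro ⟨i, j, k, ⟨h1, rfl, h2⟩, rfl⟩
      exact ⟨i, h1, h2⟩
    · rintro ⟨i, h1, h2⟩
      exact ⟨i, N, k, ⟨h1, rfl, h2⟩, rfl⟩
  · intro k
    simp only [Finset.mem_image, Finset.mem_filter, Prod.exists]
    rintro ⟨i, j, k', ⟨h1, rfl, h2⟩, rfl⟩
    obtain ⟨i', j', h3, h4, h5⟩ := hS.nested _ _ _ h1
    obtain rfl : j' = j := le_antisymm (hS.le _ _ _ h3).2 h5
    exact ⟨i', j', k, ⟨h3, rfl, hp i i' h4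
      (hS.ballot _ _ _ h3 _ h4 (hS.le _ _ _ h1).1) h2⟩, rfl⟩

lemma lt_depth (hS : IsStacking h N S) (k : ℕ) : k < depth N S ↔ ∃ i, (i, N, k) ∈ S := by
  have := hS.lt_card_filter (fun _ => True) (by simp) k
  simpa [depth] using this

lemma covers_iff (hS : IsStacking h N S) (k : ℕ) : Covers S N k ↔ k < depth N S := by
  rw [hS.lt_depth]
  constructor
  · rintro ⟨i, j, h1, h2, h3⟩
    obtain rfl : j = N := le_antisymm (hS.le _ _ _ h1).2 h3
    exact ⟨i, h1⟩
  · rintro ⟨i, h1⟩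
    exact ⟨i, N, h1, (hS.le _ _ _ h1).1, le_rfl⟩

lemma lt_lowDepth (hS : IsStacking h N S) (k : ℕ) :
    k < lowDepth h N S ↔ ∃ i, (i, N, k) ∈ S ∧ h i < h N :=
  hS.lt_card_filter (fun i => h i < h N) (fun _ _ _ h1 h2 => h1.trans_lt h2) k

lemma lt_keptDepth (hS : IsStacking h (N + 1) S) (k : ℕ) :
    k < keptDepth N S ↔ ∃ i, (i, N + 1, k) ∈ S ∧ i ≤ N :=
  hS.lt_card_filter (fun i => i ≤ N) (fun _ _ h1 _ h2 => h1.trans h2) k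

end IsStacking

/-- Extension by the column `N + 1`: the tiles with last column `N` at a level `< e` are made
longer by one box, the other ones are kept, and single boxes are added at the levels
`e, …, f - 1`. -/
def extendStack (N : ℕ) (S : Finset (ℕ × ℕ × ℕ)) (e f : ℕ) : Finset (ℕ × ℕ × ℕ) :=
  (S.image fun τ => if τ.2.1 = N ∧ τ.2.2 < e then (τ.1, N + 1, τ.2.2) else τ) ∪
    (Finset.Ico e f).image fun k => (N + 1, N + 1, k)

/-- Restriction to the columns up to `N`. -/
def truncStack (N : ℕ) (S : Finset (ℕ × ℕ × ℕ)) : Finset (ℕ × ℕ × ℕ) :=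
  (S.filter fun τ => τ.1 ≤ N).image fun τ => (τ.1, min τ.2.1 N, τ.2.2)

/-- The parameters of the extensions of `S` by the column `N + 1`. -/
structure IsChoice (h : ℕ → ℤ) (N : ℕ) (S : Finset (ℕ × ℕ × ℕ)) (e f : ℕ) : Prop where
  low_le : lowDepth h N S ≤ e
  le_depth : e ≤ depth N S
  le : e ≤ f
  down : h (N + 1) < h N → e = lowDepth h N S ∧ depth N S ≤ f ∧ f ≤ depth N S + 1
  up : h N < h (N + 1) → f ≤ depth N S ∧ depth N S ≤ f + 1

lemma mem_extendStack {e f : ℕ} {i j k : ℕ} (hS : IsStacking h N S) :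
    (i, j, k) ∈ extendStack N S e f ↔ ((i, j, k) ∈ S ∧ (j < N ∨ e ≤ k)) ∨
      (j = N + 1 ∧ k < e ∧ (i, N, k) ∈ S) ∨ (i = N + 1 ∧ j = N + 1 ∧ e ≤ k ∧ k < f) := by
  simp only [extendStack, Finset.mem_union, Finset.mem_image, Finset.mem_Ico, Prod.exists,
    Prod.mk.injEq]
  constructor
  · rintro (⟨i', j', k', h1, h2⟩ | ⟨k', h1, rfl, rfl, rfl⟩)
    · split_ifs at h2 with h3
      · simp only [Prod.mk.injEq] at h2 h3
        obtain ⟨rfl, rfl, rfl⟩ := h2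
        obtain ⟨rfl, h3⟩ := h3
        exact Or.inr (Or.inl ⟨rfl, h3, h1⟩)
      · simp only [Prod.mk.injEq] at h2 h3
        obtain ⟨rfl, rfl, rfl⟩ := h2
        have := (hS.le _ _ _ h1).2
        exact Or.inl ⟨h1, by omega⟩
    · exact Or.inr (Or.inr ⟨rfl, rfl, h1⟩)
  · rintro (⟨h1, h2⟩ | ⟨rfl, h1, h2⟩ | ⟨rfl, rfl, h1, h2⟩)
    · refine Or.inl ⟨i, j, k, h1, ?_⟩
      exact if_neg (by omega)
    · refine Or.inl ⟨i, N, k, h2, ?_⟩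
      rw [if_pos ⟨rfl, h1⟩]
    · exact Or.inr ⟨k, ⟨h1, h2⟩, rfl, rfl, rfl⟩

lemma mem_truncStack {i j k : ℕ} (hS : IsStacking h (N + 1) S) :
    (i, j, k) ∈ truncStack N S ↔ ((i, j, k) ∈ S ∧ j ≤ N) ∨
      (j = N ∧ i ≤ N ∧ (i, N + 1, k) ∈ S) := by
  simp only [truncStack, Finset.mem_image, Finset.mem_filter, Prod.exists, Prod.mk.injEq]
  constructor
  · rintro ⟨i', j', k', ⟨h1, h2⟩, rfl, rfl, rfl⟩
    have := (hS.le _ _ _ h1).2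
    rcases Nat.lt_or_ge N j' with h3 | h3
    · obtain rfl : j' = N + 1 := by omega
      exact Or.inr ⟨by omega, h2, h1⟩
    · rw [min_eq_left h3]
      exact Or.inl ⟨h1, h3⟩
  · rintro (⟨h1, h2⟩ | ⟨rfl, h1, h2⟩)
    · exact ⟨i, j, k, ⟨h1, (hS.le _ _ _ h1).1.trans h2⟩, rfl, by omega, rfl⟩
    · exact ⟨i, j + 1, k, ⟨h2, h1⟩, rfl, by omega, rfl⟩

lemma covers_extendStack {e f x k : ℕ} (hS : IsStacking h N S) (hx : x ≤ N) :
    Covers (extendStack N S e f) x k ↔ Covers S x k := by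
  constructor
  · rintro ⟨i, j, h1, h2, h3⟩
    rw [mem_extendStack hS] at h1
    rcases h1 with ⟨h1, -⟩ | ⟨rfl, -, h1⟩ | ⟨rfl, -⟩
    · exact ⟨i, j, h1, h2, h3⟩
    · exact ⟨i, N, h1, h2, hx⟩
    · omega
  · rintro ⟨i, j, h1, h2, h3⟩
    by_cases h4 : j < N ∨ e ≤ k
    · exact ⟨i, j, (mem_extendStack hS).2 (Or.inl ⟨h1, h4⟩), h2, h3⟩
    · obtain rfl : j = N := by have := (hS.le _ _ _ h1).2; omega
      exact ⟨i, j + 1, (mem_extendStack hS).2 (Or.inr (Or.inl ⟨rfl, by omega, h1⟩)), h2,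
        by omega⟩

lemma covers_extendStack_succ {e f k : ℕ} (hS : IsStacking h N S) (he : e ≤ depth N S)
    (hef : e ≤ f) : Covers (extendStack N S e f) (N + 1) k ↔ k < f := by
  constructor
  · rintro ⟨i, j, h1, h2, h3⟩
    rw [mem_extendStack hS] at h1
    rcases h1 with ⟨h1, -⟩ | ⟨rfl, h1, -⟩ | ⟨rfl, -, -, h1⟩
    · have := (hS.le _ _ _ h1).2; omega
    · omega
    · exact h1
  · intro hk
    rcases Nat.lt_or_ge k e with h1 | h1
    · obtain ⟨i, hi⟩ := (hS.lt_depth k).1 (h1.trans_le he)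
      exact ⟨i, N + 1, (mem_extendStack hS).2 (Or.inr (Or.inl ⟨rfl, h1, hi⟩)),
        by have := (hS.le _ _ _ hi).1; omega, le_rfl⟩
    · exact ⟨N + 1, N + 1, (mem_extendStack hS).2 (Or.inr (Or.inr ⟨rfl, rfl, h1, hk⟩)),
        le_rfl, le_rfl⟩

lemma covers_truncStack {x k : ℕ} (hS : IsStacking h (N + 1) S) (hx : x ≤ N) :
    Covers (truncStack N S) x k ↔ Covers S x k := by
  constructor
  · rintro ⟨i, j, h1, h2, h3⟩
    rw [mem_truncStack hS] at h1
    rcases h1 with ⟨h1, -⟩ | ⟨rfl, -, h1⟩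
    · exact ⟨i, j, h1, h2, h3⟩
    · exact ⟨i, _, h1, h2, by omega⟩
  · rintro ⟨i, j, h1, h2, h3⟩
    by_cases h4 : j ≤ N
    · exact ⟨i, j, (mem_truncStack hS).2 (Or.inl ⟨h1, h4⟩), h2, h3⟩
    · obtain rfl : j = N + 1 := by have := (hS.le _ _ _ h1).2; omega
      exact ⟨i, N, (mem_truncStack hS).2 (Or.inr ⟨rfl, by omega, h1⟩), h2, hx⟩

lemma IsStacking.extendStack (hS : IsStacking h N S)
    (hN : h (N + 1) = h N + 1 ∨ h (N + 1) = h N - 1) {e f : ℕ} (hc : IsChoice h N S e f) :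
    IsStacking h (N + 1) (extendStack N S e f) where
  le i j k h1 := by
    rw [mem_extendStack hS] at h1
    rcases h1 with ⟨h1, -⟩ | ⟨rfl, -, h1⟩ | ⟨rfl, rfl, -⟩
    · have := hS.le _ _ _ h1; omega
    · have := hS.le _ _ _ h1; omega
    · omega
  ballot i j k h1 x hix hxj := by
    rw [mem_extendStack hS] at h1
    rcases h1 with ⟨h1, -⟩ | ⟨rfl, hk, h1⟩ | ⟨rfl, rfl, -⟩
    · exact hS.ballot _ _ _ h1 x hix hxj
    · rcases Nat.lt_or_ge N x with hx | hx
      · obtain rfl : x = N + 1 := by omega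
        have h2 := hS.ballot _ _ _ h1 N (hS.le _ _ _ h1).1 le_rfl
        rcases hN with hN | hN
        · omega
        -- A tile prolonged over a down step has level below `lowDepth`, so it starts strictly below
        -- `h N` and has room for the step.
        · rw [(hc.down (by omega)).1, hS.lt_lowDepth] at hk
          obtain ⟨i', h3, h4⟩ := hk
          obtain rfl := (hS.unique _ _ _ _ _ N h1 h3 (hS.le _ _ _ h1).1 le_rfl
            (hS.le _ _ _ h3).1 le_rfl).1
          omega
      · exact hS.ballot _ _ _ h1 x hix hx
    · obtain rfl : x = N + 1 := by omega
      exact le_rfl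
  closed i j k h1 hj := by
    rw [mem_extendStack hS] at h1
    rcases h1 with ⟨h1, h2⟩ | ⟨rfl, hk, h1⟩ | ⟨rfl, rfl, -⟩
    · rcases Nat.lt_or_ge j N with h3 | h3
      · exact hS.closed _ _ _ h1 h3
      · obtain rfl : j = N := by omega
        -- A tile that is not prolonged has level at least `lowDepth`, so it starts at height
        -- exactly `h N` and may end there as a Dyck tile.
        have h4 : ¬ k < lowDepth h j S := by have := hc.low_le; omega
        rw [hS.lt_lowDepth] at h4
        push Not at h4
        exact le_antisymm (h4 i h1) (hS.ballot _ _ _ h1 _ (hS.le _ _ _ h1).1 le_rfl)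
    · omega
    · omega
  unique i j i' j' k x h1 h2 hix hxj hix' hxj' := by
    rw [mem_extendStack hS] at h1 h2
    rcases h1 with ⟨h1, h3⟩ | ⟨rfl, hk, h1⟩ | ⟨rfl, rfl, h3, h4⟩ <;>
      rcases h2 with ⟨h2, h5⟩ | ⟨rfl, hk', h2⟩ | ⟨rfl, rfl, h5, h6⟩
    · exact hS.unique _ _ _ _ _ _ h1 h2 hix hxj hix' hxj'
    · have := (hS.le _ _ _ h1).2
      have := hS.unique _ _ _ _ _ x h1 h2 hix hxj hix' (by omega)
      omega
    · have := (hS.le _ _ _ h1).2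
      omega
    · have := (hS.le _ _ _ h2).2
      have := hS.unique _ _ _ _ _ x h1 h2 hix (by omega) hix' hxj'
      omega
    · exact ⟨(hS.unique _ _ _ _ _ N h1 h2 (hS.le _ _ _ h1).1 le_rfl (hS.le _ _ _ h2).1
        le_rfl).1, rfl⟩
    · omega
    · have := (hS.le _ _ _ h2).2
      omega
    · omega
    · exact ⟨rfl, rfl⟩
  nested i j k h1 := by
    simp only [mem_extendStack hS] at h1 ⊢
    rcases h1 with ⟨h1, h2⟩ | ⟨rfl, hk, h1⟩ | ⟨rfl, rfl, h2, h3⟩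
    · obtain ⟨i', j', h3, h4, h5⟩ := hS.nested _ _ _ h1
      have h6 := (hS.le _ _ _ h3).2
      by_cases h7 : j' < N ∨ e ≤ k
      · exact ⟨i', j', Or.inl ⟨h3, h7⟩, h4, h5⟩
      · obtain rfl : j' = N := by omega
        exact ⟨i', j' + 1, Or.inr (Or.inl ⟨rfl, by omega, h3⟩), h4, by omega⟩
    · obtain ⟨i', j', h3, h4, h5⟩ := hS.nested _ _ _ h1
      obtain rfl : j' = N := le_antisymm (hS.le _ _ _ h3).2 h5
      exact ⟨i', j' + 1, Or.inr (Or.inl ⟨rfl, by omega, h3⟩), h4, le_rfl⟩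
    · rcases Nat.lt_or_ge k e with h4 | h4
      · obtain ⟨i, hi⟩ := (hS.lt_depth k).1 (h4.trans_le hc.le_depth)
        exact ⟨i, N + 1, Or.inr (Or.inl ⟨rfl, h4, hi⟩),
          by have := (hS.le _ _ _ hi).1; omega, le_rfl⟩
      · exact ⟨N + 1, N + 1, Or.inr (Or.inr ⟨rfl, rfl, h4, by omega⟩), le_rfl, le_rfl⟩
  not_covers_zero k := by
    rw [covers_extendStack hS (Nat.zero_le N)]
    exact hS.not_covers_zero k
  down x k hx hd := by
    rw [covers_extendStack hS (show x ≤ N by omega)]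
    rcases Nat.lt_or_ge x N with hxN | hxN
    · rw [covers_extendStack hS (by omega)]
      exact hS.down x k hxN hd
    · obtain rfl : x = N := by omega
      rw [covers_extendStack_succ hS hc.le_depth hc.le, hS.covers_iff]
      have := hc.down hd
      omega
  down' x k hx hd := by
    rw [covers_extendStack hS (show x ≤ N by omega)]
    rcases Nat.lt_or_ge x N with hxN | hxN
    · rw [covers_extendStack hS (by omega)]
      exact hS.down' x k hxN hd
    · obtain rfl : x = N := by omega
      rw [covers_extendStack_succ hS hc.le_depth hc.le, hS.covers_iff]
      have := hc.down hd
      omega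
  up x k hx hd := by
    rw [covers_extendStack hS (show x ≤ N by omega)]
    rcases Nat.lt_or_ge x N with hxN | hxN
    · rw [covers_extendStack hS (by omega)]
      exact hS.up x k hxN hd
    · obtain rfl : x = N := by omega
      rw [covers_extendStack_succ hS hc.le_depth hc.le, hS.covers_iff]
      have := hc.up hd
      omega
  up' x k hx hd := by
    rw [covers_extendStack hS (show x ≤ N by omega)]
    rcases Nat.lt_or_ge x N with hxN | hxN
    · rw [covers_extendStack hS (by omega)]
      exact hS.up' x k hxN hd
    · obtain rfl : x = N := by omega
      rw [covers_extendStack_succ hS hc.le_depth hc.le, hS.covers_iff]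
      have := hc.up hd
      omega

lemma IsStacking.truncStack (hS : IsStacking h (N + 1) S) : IsStacking h N (truncStack N S) where
  le i j k h1 := by
    rw [mem_truncStack hS] at h1
    rcases h1 with ⟨h1, h2⟩ | ⟨rfl, h2, h1⟩
    · exact ⟨(hS.le _ _ _ h1).1, h2⟩
    · exact ⟨h2, le_rfl⟩
  ballot i j k h1 x hix hxj := by
    rw [mem_truncStack hS] at h1
    rcases h1 with ⟨h1, h2⟩ | ⟨rfl, h2, h1⟩
    · exact hS.ballot _ _ _ h1 x hix hxj
    · exact hS.ballot _ _ _ h1 x hix (by omega)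
  closed i j k h1 hj := by
    rw [mem_truncStack hS] at h1
    rcases h1 with ⟨h1, h2⟩ | ⟨rfl, h2, h1⟩
    · exact hS.closed _ _ _ h1 (by omega)
    · omega
  unique i j i' j' k x h1 h2 hix hxj hix' hxj' := by
    rw [mem_truncStack hS] at h1 h2
    rcases h1 with ⟨h1, h3⟩ | ⟨rfl, h3, h1⟩ <;> rcases h2 with ⟨h2, h4⟩ | ⟨rfl, h4, h2⟩
    · exact hS.unique _ _ _ _ _ _ h1 h2 hix hxj hix' hxj'
    · have := hS.unique _ _ _ _ _ x h1 h2 hix hxj hix' (by omega)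
      omega
    · have := hS.unique _ _ _ _ _ x h1 h2 hix (by omega) hix' hxj'
      omega
    · have := hS.unique _ _ _ _ _ x h1 h2 hix (by omega) hix' (by omega)
      omega
  nested i j k h1 := by
    simp only [mem_truncStack hS] at h1 ⊢
    obtain ⟨j₁, h1, h2, h2'⟩ : ∃ j₁, (i, j₁, k + 1) ∈ S ∧ j ≤ j₁ ∧ j ≤ N ∧ i ≤ N := by
      rcases h1 with ⟨h1, h2⟩ | ⟨rfl, h2, h1⟩
      · exact ⟨j, h1, le_rfl, h2, (hS.le _ _ _ h1).1.trans h2⟩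
      · exact ⟨j + 1, h1, by omega, le_rfl, h2⟩
    obtain ⟨i', j', h3, h4, h5⟩ := hS.nested _ _ _ h1
    have h6 := (hS.le _ _ _ h3).2
    by_cases h7 : j' ≤ N
    · exact ⟨i', j', Or.inl ⟨h3, h7⟩, h4, by omega⟩
    · obtain rfl : j' = N + 1 := by omega
      exact ⟨i', N, Or.inr ⟨rfl, by omega, h3⟩, h4, h2'.1⟩
  not_covers_zero k := by
    rw [covers_truncStack hS (Nat.zero_le N)]
    exact hS.not_covers_zero k
  down x k hx hd := by
    rw [covers_truncStack hS (by omega), covers_truncStack hS (by omega)]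
    exact hS.down x k (by omega) hd
  down' x k hx hd := by
    rw [covers_truncStack hS (by omega), covers_truncStack hS (by omega)]
    exact hS.down' x k (by omega) hd
  up x k hx hd := by
    rw [covers_truncStack hS (by omega), covers_truncStack hS (by omega)]
    exact hS.up x k (by omega) hd
  up' x k hx hd := by
    rw [covers_truncStack hS (by omega), covers_truncStack hS (by omega)]
    exact hS.up' x k (by omega) hd

lemma IsStacking.isChoice (hS : IsStacking h (N + 1) S) :
    IsChoice h N (BallotTiling.truncStack N S) (keptDepth N S) (depth (N + 1) S) := by
  have hT := hS.truncStack
  have hcov : ∀ k, Covers S N k ↔ k < depth N (BallotTiling.truncStack N S) := fun k => by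
    rw [← hT.covers_iff, covers_truncStack hS le_rfl]
  have hcov' := hS.covers_iff
  -- A tile of `S` ending at N returns to its starting height, so a truncated tile that starts below
  -- `h N` must come from one that goes on to N + 1.
  have hlow : lowDepth h N (BallotTiling.truncStack N S) ≤ keptDepth N S := by
    refine le_of_forall_lt fun k hk => ?_
    obtain ⟨i, h1, h2⟩ := (hT.lt_lowDepth k).1 hk
    rw [hS.lt_keptDepth]
    rcases (mem_truncStack hS).1 h1 with ⟨h1, -⟩ | ⟨-, h3, h1⟩
    · have := hS.closed _ _ _ h1 (by omega)
      omega
    · exact ⟨i, h1, h3⟩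
  refine ⟨hlow, ?_, ?_, fun hd => ⟨le_antisymm ?_ hlow, ?_, ?_⟩, fun hd => ⟨?_, ?_⟩⟩
  · refine le_of_forall_lt fun k hk => (hcov k).1 ?_
    obtain ⟨i, h1, h2⟩ := (hS.lt_keptDepth k).1 hk
    exact ⟨i, _, h1, h2, by omega⟩
  · refine le_of_forall_lt fun k hk => (hcov' k).1 ?_
    obtain ⟨i, h1, h2⟩ := (hS.lt_keptDepth k).1 hk
    exact ⟨i, _, h1, by omega, le_rfl⟩
  -- A tile that survives the down step starts no higher than `h (N + 1)`, hence below `h N`.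
  · refine le_of_forall_lt fun k hk => ?_
    obtain ⟨i, h1, h2⟩ := (hS.lt_keptDepth k).1 hk
    exact (hT.lt_lowDepth k).2 ⟨i, (mem_truncStack hS).2 (Or.inr ⟨rfl, h2, h1⟩),
      (hS.ballot _ _ _ h1 (N + 1) (by omega) le_rfl).trans_lt hd⟩
  · exact le_of_forall_lt fun k hk => (hcov' k).1 (hS.down N k (by omega) hd ((hcov k).2 hk))
  · by_contra! hk
    exact lt_irrefl _ ((hcov _).1 (hS.down' N _ (by omega) hd ((hcov' _).2 hk)))
  · exact le_of_forall_lt fun k hk => (hcov k).1 (hS.up N k (by omega) hd ((hcov' k).2 hk))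
  · by_contra! hk
    exact lt_irrefl _ ((hcov' _).1 (hS.up' N _ (by omega) hd ((hcov _).2 hk)))

lemma IsStacking.extendStack_truncStack (hS : IsStacking h (N + 1) S) :
    BallotTiling.extendStack N (BallotTiling.truncStack N S) (keptDepth N S) (depth (N + 1) S) =
      S := by
  ext ⟨i, j, k⟩
  have hk : keptDepth N S ≤ k ↔ ¬ ∃ i, (i, N + 1, k) ∈ S ∧ i ≤ N := by
    rw [← hS.lt_keptDepth, not_lt]
  rw [mem_extendStack hS.truncStack, mem_truncStack hS, mem_truncStack hS, hk,
    hS.lt_keptDepth, hS.lt_depth]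
  constructor
  · rintro (⟨⟨h1, -⟩ | ⟨rfl, h2, h1⟩, h3⟩ | ⟨rfl, ⟨i', h1, h2⟩, h3⟩ | ⟨rfl, rfl, h1, i', h2⟩)
    · exact h1
    · exact absurd ⟨i, h1, h2⟩ (h3.resolve_left (lt_irrefl _))
    · rcases h3 with ⟨h3, -⟩ | ⟨-, -, h3⟩
      · have := (hS.le _ _ _ h3).1
        have := hS.unique _ _ _ _ _ N h1 h3 h2 (by omega) this le_rfl
        omega
      · exact h3
    · have h3 := (hS.le _ _ _ h2).1
      rcases h3.lt_or_eq with h4 | rfl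
      · exact absurd ⟨i', h2, by omega⟩ h1
      · exact h2
  · intro h1
    have h2 := hS.le _ _ _ h1
    rcases Nat.lt_or_ge N j with h3 | h3
    · obtain rfl : j = N + 1 := by omega
      rcases Nat.lt_or_ge N i with h4 | h4
      · obtain rfl : i = N + 1 := by omega
        refine Or.inr (Or.inr ⟨rfl, rfl, ?_, _, h1⟩)
        rintro ⟨i', h5, h6⟩
        have := hS.unique _ _ _ _ _ (N + 1) h1 h5 le_rfl le_rfl (by omega) le_rfl
        omega
      · exact Or.inr (Or.inl ⟨rfl, ⟨i, h1, h4⟩, Or.inr ⟨rfl, h4, h1⟩⟩)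
    · refine Or.inl ⟨Or.inl ⟨h1, h3⟩, ?_⟩
      by_contra! h4
      obtain ⟨h4, i', h5, h6⟩ := h4
      have := hS.unique _ _ _ _ _ N h1 h5 (by omega) h4 h6 (by omega)
      omega

lemma IsStacking.truncStack_extendStack (hS : IsStacking h N S)
    (hN : h (N + 1) = h N + 1 ∨ h (N + 1) = h N - 1) {e f : ℕ} (hc : IsChoice h N S e f) :
    BallotTiling.truncStack N (BallotTiling.extendStack N S e f) = S := by
  ext ⟨i, j, k⟩
  rw [mem_truncStack (hS.extendStack hN hc), mem_extendStack hS, mem_extendStack hS]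
  constructor
  · rintro (⟨⟨h1, -⟩ | ⟨rfl, -⟩ | ⟨rfl, rfl, -⟩, h2⟩ | ⟨rfl, h1, ⟨h2, -⟩ | ⟨-, -, h2⟩ | ⟨rfl, -⟩⟩)
    · exact h1
    · omega
    · omega
    · have := (hS.le _ _ _ h2).2; omega
    · exact h2
    · omega
  · intro h1
    have h2 := hS.le _ _ _ h1
    by_cases h3 : j < N ∨ e ≤ k
    · exact Or.inl ⟨Or.inl ⟨h1, h3⟩, h2.2⟩
    · obtain rfl : j = N := by omega
      exact Or.inr ⟨rfl, h2.1, Or.inr (Or.inl ⟨rfl, by omega, h1⟩)⟩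

lemma IsStacking.depth_extendStack (hS : IsStacking h N S)
    (hN : h (N + 1) = h N + 1 ∨ h (N + 1) = h N - 1) {e f : ℕ} (hc : IsChoice h N S e f) :
    depth (N + 1) (BallotTiling.extendStack N S e f) = f := by
  refine eq_of_forall_lt_iff fun k => ?_
  rw [← (hS.extendStack hN hc).covers_iff, covers_extendStack_succ hS hc.le_depth hc.le]

lemma IsStacking.keptDepth_extendStack (hS : IsStacking h N S)
    (hN : h (N + 1) = h N + 1 ∨ h (N + 1) = h N - 1) {e f : ℕ} (hc : IsChoice h N S e f) :
    keptDepth N (BallotTiling.extendStack N S e f) = e := by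
  refine eq_of_forall_lt_iff fun k => ?_
  rw [(hS.extendStack hN hc).lt_keptDepth]
  constructor
  · rintro ⟨i, h1, h2⟩
    rcases (mem_extendStack hS).1 h1 with ⟨h1, -⟩ | ⟨-, h1, -⟩ | ⟨rfl, -⟩
    · have := (hS.le _ _ _ h1).2; omega
    · exact h1
    · omega
  · intro hk
    obtain ⟨i, hi⟩ := (hS.lt_depth k).1 (hk.trans_le hc.le_depth)
    exact ⟨i, (mem_extendStack hS).2 (Or.inr (Or.inl ⟨rfl, hk, hi⟩)), (hS.le _ _ _ hi).1⟩

open Classical in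
/-- The finite set of the parameters of the extensions of `S` by the column `N + 1`. -/
noncomputable def choices (h : ℕ → ℤ) (N : ℕ) (S : Finset (ℕ × ℕ × ℕ)) : Finset (ℕ × ℕ) :=
  (Finset.range (depth N S + 1) ×ˢ Finset.range (depth N S + 2)).filter fun c =>
    IsChoice h N S c.1 c.2

lemma mem_choices (hN : h (N + 1) = h N + 1 ∨ h (N + 1) = h N - 1) {c : ℕ × ℕ} :
    c ∈ choices h N S ↔ IsChoice h N S c.1 c.2 := by
  simp only [choices, Finset.mem_filter, Finset.mem_product, Finset.mem_range,
    and_iff_right_iff_imp]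
  intro hc
  refine ⟨by have := hc.le_depth; omega, ?_⟩
  rcases hN with hN | hN
  · have := hc.up (by omega); omega
  · have := hc.down (by omega); omega

/-- The finite set of the stackings with columns `0, …, N`. -/
noncomputable def stackings (h : ℕ → ℤ) : ℕ → Finset (Finset (ℕ × ℕ × ℕ))
  | 0 => {∅}
  | N + 1 => (stackings h N).biUnion fun S =>
      (choices h N S).image fun c => extendStack N S c.1 c.2

lemma mem_stackings (hN : ∀ x < N, h (x + 1) = h x + 1 ∨ h (x + 1) = h x - 1) :
    S ∈ stackings h N ↔ IsStacking h N S := by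
  induction N generalizing S with
  | zero =>
    rw [stackings, Finset.mem_singleton]
    constructor
    · rintro rfl
      constructor <;> simp [Covers]
    · intro hS
      refine Finset.eq_empty_of_forall_notMem ?_
      rintro ⟨i, j, k⟩ h1
      have := hS.le _ _ _ h1
      exact hS.not_covers_zero k ⟨i, j, h1, by omega, by omega⟩
  | succ N ih =>
    replace ih := fun S => @ih S fun x hx => hN x (by omega)
    have hN := hN N (by omega)
    simp only [stackings, Finset.mem_biUnion, Finset.mem_image, ih, mem_choices hN, Prod.exists]
    constructor
    · rintro ⟨S', hS', e, f, hc, rfl⟩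
      exact hS'.extendStack hN hc
    · intro hS
      exact ⟨_, hS.truncStack, _, _, hS.isChoice, hS.extendStack_truncStack⟩

/-- No stacking is produced twice: S, e and f are recovered from the extension by `truncStack`,
`keptDepth` and `depth`. -/
lemma sum_stackings_succ {A : Type*} [AddCommMonoid A]
    (hN : ∀ x < N + 1, h (x + 1) = h x + 1 ∨ h (x + 1) = h x - 1)
    (w : Finset (ℕ × ℕ × ℕ) → A) :
    ∑ S ∈ stackings h (N + 1), w S =
      ∑ S ∈ stackings h N, ∑ c ∈ choices h N S, w (extendStack N S c.1 c.2) := by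
  have hmem : ∀ S, S ∈ stackings h N ↔ IsStacking h N S := fun S =>
    mem_stackings fun x hx => hN x (by omega)
  have hN := hN N (by omega)
  rw [stackings, Finset.sum_biUnion]
  · refine Finset.sum_congr rfl fun S hS => Finset.sum_image ?_
    rintro ⟨e, f⟩ hc ⟨e', f'⟩ hc' heq
    rw [Finset.mem_coe, mem_choices hN] at hc hc'
    rw [hmem] at hS
    dsimp only at hc hc' heq
    rw [Prod.mk.injEq]
    constructor
    · rw [← hS.keptDepth_extendStack hN hc, heq, hS.keptDepth_extendStack hN hc']
    · rw [← hS.depth_extendStack hN hc, heq, hS.depth_extendStack hN hc']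
  · intro S hS S' hS' hne
    refine Finset.disjoint_left.2 fun T hT hT' => hne ?_
    rw [Finset.mem_image] at hT hT'
    obtain ⟨c, hc, rfl⟩ := hT
    obtain ⟨c', hc', heq⟩ := hT'
    rw [mem_choices hN] at hc hc'
    rw [Finset.mem_coe, hmem] at hS hS'
    rw [← hS.truncStack_extendStack hN hc, ← heq, hS'.truncStack_extendStack hN hc']

/-! ### Weights of stackings and of their extensions -/

section Weights

variable {A : Type*} [CommRing A]

/-- The weight of a tile in the generating function of the stackings: `q ^ art`, with a factor
`x a` for a tile which starts at the height `a` and has last column `N`. -/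
def tileWeight (h : ℕ → ℤ) (N : ℕ) (q : A) (x : ℤ → A) (τ : ℕ × ℕ × ℕ) : A :=
  q ^ downs h τ.1 τ.2.1 * if τ.2.1 = N then x (h τ.1) else q

/-- The generating function of the stackings. -/
noncomputable def stackSum (h : ℕ → ℤ) (N : ℕ) (q : A) (x : ℤ → A) : A :=
  ∑ S ∈ stackings h N, ∏ τ ∈ S, tileWeight h N q x τ

/-- The part of the weight of a stacking which does not depend on the variables. -/
def coreWeight (h : ℕ → ℤ) (N : ℕ) (q : A) (S : Finset (ℕ × ℕ × ℕ)) : A :=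
  ∏ τ ∈ S, (q ^ downs h τ.1 τ.2.1 * if τ.2.1 = N then 1 else q)

/-- The part of the weight of a stacking which comes from the tiles with last column `N` starting
below the height of `N`. -/
def lowWeight (h : ℕ → ℤ) (N : ℕ) (x : ℤ → A) (S : Finset (ℕ × ℕ × ℕ)) : A :=
  ∏ τ ∈ S with τ.2.1 = N ∧ h τ.1 < h N, x (h τ.1)

/-- Among the tiles ending at N, those starting below `h N` occupy the lowest levels; above them
there is one tile on each level up to `depth`, starting at `h N` exactly. -/
lemma IsStacking.prod_anchored (hS : IsStacking h N S) (F : ℤ → ℕ → A) :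
    ∏ τ ∈ S with τ.2.1 = N, F (h τ.1) τ.2.2 =
      (∏ τ ∈ S with τ.2.1 = N ∧ h τ.1 < h N, F (h τ.1) τ.2.2) *
        ∏ k ∈ Finset.Ico (lowDepth h N S) (depth N S), F (h N) k := by
  rw [← Finset.prod_filter_mul_prod_filter_not (S.filter fun τ => τ.2.1 = N)
    (fun τ => h τ.1 < h N), Finset.filter_filter, Finset.filter_filter]
  congr 1
  refine Finset.prod_bij (fun τ _ => τ.2.2) ?_ ?_ ?_ ?_
  · rintro ⟨i, j, k⟩ hτ
    simp only [Finset.mem_filter] at hτ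
    obtain ⟨h1, rfl, h2⟩ := hτ
    rw [Finset.mem_Ico, ← not_lt, hS.lt_depth, hS.lt_lowDepth]
    refine ⟨?_, i, h1⟩
    rintro ⟨i', h3, h4⟩
    obtain rfl := (hS.unique _ _ _ _ _ _ h1 h3 (hS.le _ _ _ h1).1 le_rfl
      (hS.le _ _ _ h3).1 le_rfl).1
    exact h2 h4
  · rintro ⟨i, j, k⟩ hτ ⟨i', j', k'⟩ hτ' (rfl : k = k')
    simp only [Finset.mem_filter] at hτ hτ'
    obtain ⟨h1, rfl, -⟩ := hτ
    obtain ⟨h3, rfl, -⟩ := hτ'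
    rw [(hS.unique _ _ _ _ _ _ h1 h3 (hS.le _ _ _ h1).1 le_rfl (hS.le _ _ _ h3).1 le_rfl).1]
  · intro k hk
    rw [Finset.mem_Ico, ← not_lt, hS.lt_depth, hS.lt_lowDepth] at hk
    obtain ⟨hk, i, hi⟩ := hk
    exact ⟨(i, N, k), Finset.mem_filter.2 ⟨hi, rfl, fun h1 => hk ⟨i, hi, h1⟩⟩, rfl⟩
  · rintro ⟨i, j, k⟩ hτ
    simp only [Finset.mem_filter] at hτ
    obtain ⟨h1, rfl, h2⟩ := hτ
    have := hS.ballot _ _ _ h1 _ (hS.le _ _ _ h1).1 le_rfl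
    rw [le_antisymm this (not_lt.1 h2)]

lemma IsStacking.prod_tileWeight (hS : IsStacking h N S) (q : A) (x : ℤ → A) :
    ∏ τ ∈ S, tileWeight h N q x τ =
      coreWeight h N q S * lowWeight h N x S * x (h N) ^ (depth N S - lowDepth h N S) := by
  have h1 : ∀ τ, tileWeight h N q x τ = (q ^ downs h τ.1 τ.2.1 * if τ.2.1 = N then 1 else q) *
      if τ.2.1 = N then x (h τ.1) else 1 := by
    intro τ
    rw [tileWeight]
    split_ifs <;> ring
  simp only [h1]
  rw [Finset.prod_mul_distrib, ← Finset.prod_filter, hS.prod_anchored fun a _ => x a]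
  simp [coreWeight, lowWeight, mul_assoc]

/-- A prolonged tile keeps its variable and gains q if the step is down; a tile left behind trades
its variable for q; each new single box contributes `x (h (N + 1))`. -/
lemma IsStacking.prod_tileWeight_extendStack (hS : IsStacking h N S)
    (q : A) (x : ℤ → A) {e f : ℕ} (hc : IsChoice h N S e f) :
    ∏ τ ∈ BallotTiling.extendStack N S e f, tileWeight h (N + 1) q x τ =
      coreWeight h N q S * lowWeight h N x S *
        ((if h (N + 1) < h N then q ^ e else 1) * x (h N) ^ (e - lowDepth h N S) *
          q ^ (depth N S - e) * x (h (N + 1)) ^ (f - e)) := by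
  have h1 : ∀ τ ∈ S, tileWeight h (N + 1) q x
      (if τ.2.1 = N ∧ τ.2.2 < e then (τ.1, N + 1, τ.2.2) else τ) =
        (q ^ downs h τ.1 τ.2.1 * if τ.2.1 = N then 1 else q) *
          if τ.2.1 = N then
            if τ.2.2 < e then (if h (N + 1) < h N then q else 1) * x (h τ.1) else q else 1 := by
    rintro ⟨i, j, k⟩ hτ
    have h2 := hS.le _ _ _ hτ
    by_cases hj : j = N
    · subst hj
      by_cases hk : k < e
      · simp only [hk, and_self, if_true, tileWeight, downs_succ h h2.1]
        split_ifs <;> ring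
      · simp [hk, tileWeight]
    · simp [hj, tileWeight, show j ≠ N + 1 by omega]
  rw [BallotTiling.extendStack, Finset.prod_union, Finset.prod_image, Finset.prod_image,
    Finset.prod_congr rfl h1, Finset.prod_mul_distrib, ← Finset.prod_filter,
    hS.prod_anchored fun a k => if k < e then (if h (N + 1) < h N then q else 1) * x a else q]
  · have h3 : ∏ τ ∈ S with τ.2.1 = N ∧ h τ.1 < h N,
        (if τ.2.2 < e then (if h (N + 1) < h N then q else 1) * x (h τ.1) else q) =
          (if h (N + 1) < h N then q else 1) ^ lowDepth h N S * lowWeight h N x S := by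
      rw [lowWeight, lowDepth, ← Finset.prod_const, ← Finset.prod_mul_distrib]
      refine Finset.prod_congr rfl ?_
      rintro ⟨i, j, k⟩ hτ
      simp only [Finset.mem_filter] at hτ
      obtain ⟨h4, rfl, h5⟩ := hτ
      exact if_pos (((hS.lt_lowDepth k).2 ⟨i, h4, h5⟩).trans_le hc.low_le)
    have h4 : ∏ k ∈ Finset.Ico (lowDepth h N S) (depth N S),
        (if k < e then (if h (N + 1) < h N then q else 1) * x (h N) else q) =
          ((if h (N + 1) < h N then q else 1) * x (h N)) ^ (e - lowDepth h N S) *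
            q ^ (depth N S - e) := by
      rw [← Finset.prod_Ico_consecutive _ hc.low_le hc.le_depth,
        Finset.prod_congr rfl fun k hk => if_pos (Finset.mem_Ico.1 hk).2,
        Finset.prod_congr (s₁ := Finset.Ico e _) rfl
          fun k hk => if_neg (Finset.mem_Ico.1 hk).1.not_gt]
      simp
    have h5 : (if h (N + 1) < h N then q ^ e else 1) =
        (if h (N + 1) < h N then q else 1) ^ lowDepth h N S *
          (if h (N + 1) < h N then q else 1) ^ (e - lowDepth h N S) := by
      rw [← pow_add, Nat.add_sub_cancel' hc.low_le]
      split_ifs <;> simp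
    have h6 : ∏ k ∈ Finset.Ico e f, tileWeight h (N + 1) q x (N + 1, N + 1, k) =
        x (h (N + 1)) ^ (f - e) := by simp [tileWeight, downs_self]
    rw [h3, h4, h5, h6, mul_pow, coreWeight]
    ring
  · intro k _ k' _ hk
    simpa using hk
  · rintro ⟨i, j, k⟩ h1 ⟨i', j', k'⟩ h2 heq
    have h3 := hS.le _ _ _ h1
    have h4 := hS.le _ _ _ h2
    simp only at heq
    split_ifs at heq <;> simp only [Prod.mk.injEq] at heq ⊢ <;> omega
  · refine Finset.disjoint_left.2 ?_
    rintro ⟨i, j, k⟩ h1 h2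
    simp only [Finset.mem_image, Prod.exists, Prod.mk.injEq] at h1 h2
    obtain ⟨i', j', k', h1, h3⟩ := h1
    obtain ⟨k'', -, rfl, rfl, -⟩ := h2
    have := hS.le _ _ _ h1
    split_ifs at h3 <;> simp only [Prod.mk.injEq] at h3 <;> omega

end Weights

end Stackings

/-! ### The recursion for the generating function and its solution -/

section Recursion

variable {A : Type*} [CommRing A] {h : ℕ → ℤ} {N : ℕ}

/-- The low tiles are prolonged, each gaining q. The m tiles starting at `h N` are closed, each
giving q, and m or m + 1 single boxes appear instead: their variables become q x_{a-1}, and the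
choice gives the factor 1 + x_{a-1}. -/
lemma stackSum_down (hN : ∀ x < N + 1, h (x + 1) = h x + 1 ∨ h (x + 1) = h x - 1)
    (hd : h (N + 1) < h N) (q : A) (x : ℤ → A) :
    stackSum h (N + 1) q x = (1 + x (h (N + 1))) *
      stackSum h N q fun b => q * Function.update x (h N) (x (h (N + 1))) b := by
  rw [stackSum, stackSum, sum_stackings_succ hN, Finset.mul_sum]
  refine Finset.sum_congr rfl fun S hS => ?_
  rw [mem_stackings fun y hy => hN y (by omega)] at hS
  have hle : lowDepth h N S ≤ depth N S :=
    le_of_forall_lt fun k hk => (hS.lt_depth k).2 <| by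
      obtain ⟨i, hi, -⟩ := (hS.lt_lowDepth k).1 hk
      exact ⟨i, hi⟩
  have hch : choices h N S =
      {(lowDepth h N S, depth N S), (lowDepth h N S, depth N S + 1)} := by
    ext ⟨e, f⟩
    rw [mem_choices (hN N (by omega))]
    simp only [Finset.mem_insert, Finset.mem_singleton, Prod.mk.injEq]
    constructor
    · intro hc
      have := hc.down hd
      omega
    · rintro (⟨rfl, rfl⟩ | ⟨rfl, rfl⟩) <;>
        constructor <;> omega
  have hlow : lowWeight h N (fun b => q * Function.update x (h N) (x (h (N + 1))) b) S =
      q ^ lowDepth h N S * lowWeight h N x S := by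
    rw [lowWeight, lowWeight, lowDepth, ← Finset.prod_const, ← Finset.prod_mul_distrib]
    refine Finset.prod_congr rfl fun τ hτ => ?_
    rw [Function.update_of_ne (Finset.mem_filter.1 hτ).2.2.ne]
  have hc : ∀ c ∈ choices h N S, IsChoice h N S c.1 c.2 := fun c hc =>
    (mem_choices (hN N (by omega))).1 hc
  rw [Finset.sum_congr rfl fun c h1 => hS.prod_tileWeight_extendStack q x (hc c h1),
    hS.prod_tileWeight, hlow, hch, Finset.sum_pair (by simp)]
  obtain ⟨m, hm⟩ := Nat.exists_eq_add_of_le hle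
  simp only [hd, if_true, Function.update_self, hm, Nat.sub_self, Nat.add_sub_cancel_left,
    add_assoc, mul_pow, pow_succ]
  ring

/-- Let m tiles start at height `h N`, let a of them be prolonged, and put x = `x (h N)`, y = `q * x
(h (N + 1))`. The possible weights are x^a y^(m-a) and, with one box fewer, q x^a y^(m-1-a); their
sum is the divided difference of X^m. Substituting X for `x (h N)` makes the old generating function
a polynomial in that variable. -/
lemma stackSum_up (hN : ∀ x < N + 1, h (x + 1) = h x + 1 ∨ h (x + 1) = h x - 1)
    (hd : h N < h (N + 1)) (q : A) (x : ℤ → A) :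
    stackSum h (N + 1) q x = divDiff q (x (h N)) (q * x (h (N + 1)))
      (stackSum h N (Polynomial.C q)
        (Function.update (fun b => Polynomial.C (x b)) (h N) Polynomial.X)) := by
  rw [stackSum, stackSum, sum_stackings_succ hN, map_sum]
  refine Finset.sum_congr rfl fun S hS => ?_
  rw [mem_stackings fun y hy => hN y (by omega)] at hS
  have hle : lowDepth h N S ≤ depth N S :=
    le_of_forall_lt fun k hk => (hS.lt_depth k).2 <| by
      obtain ⟨i, hi, -⟩ := (hS.lt_lowDepth k).1 hk
      exact ⟨i, hi⟩
  obtain ⟨m, hm⟩ := Nat.exists_eq_add_of_le hle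
  -- For f = depth - 1 there is one value of e fewer, since e ≤ f.
  have hch : choices h N S =
      (Finset.range (m + 1)).image (fun a => (lowDepth h N S + a, depth N S)) ∪
        (Finset.range m).image (fun a => (lowDepth h N S + a, depth N S - 1)) := by
    ext ⟨e, f⟩
    rw [mem_choices (hN N (by omega))]
    simp only [Finset.mem_union, Finset.mem_image, Finset.mem_range, Prod.mk.injEq]
    constructor
    · intro hc
      obtain ⟨h1, h2, h3, -, h4⟩ := hc
      have := h4 hd
      rcases this.1.lt_or_eq with h5 | h5
      · exact Or.inr ⟨e - lowDepth h N S, by omega, by omega, by omega⟩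
      · exact Or.inl ⟨e - lowDepth h N S, by omega, by omega, by omega⟩
    · rintro (⟨a, ha, rfl, rfl⟩ | ⟨a, ha, rfl, rfl⟩) <;>
        constructor <;> omega
  have hlow : lowWeight h N (Function.update (fun b => Polynomial.C (x b)) (h N) Polynomial.X) S =
      Polynomial.C (lowWeight h N x S) := by
    rw [lowWeight, lowWeight, map_prod]
    refine Finset.prod_congr rfl fun τ hτ => ?_
    rw [Function.update_of_ne (Finset.mem_filter.1 hτ).2.2.ne]
  have hcore : coreWeight h N (Polynomial.C q) S = Polynomial.C (coreWeight h N q S) := by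
    simp only [coreWeight, map_prod, map_mul, map_pow, apply_ite Polynomial.C, map_one]
  have hc : ∀ c ∈ choices h N S, IsChoice h N S c.1 c.2 := fun c hc =>
    (mem_choices (hN N (by omega))).1 hc
  rw [Finset.sum_congr rfl fun c h1 => hS.prod_tileWeight_extendStack q x (hc c h1),
    hS.prod_tileWeight, hlow, hcore, ← Polynomial.C_mul, divDiff_C_mul, Function.update_self,
    divDiff_X_pow, ← Finset.mul_sum, hch, Finset.sum_union, Finset.sum_image, Finset.sum_image,
    hm, Nat.add_sub_cancel_left, homSum, homSum, Finset.mul_sum]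
  · congr 2
    · refine Finset.sum_congr rfl fun a ha => ?_
      rw [if_neg hd.not_gt, Nat.add_sub_cancel_left, Nat.add_sub_add_left, Nat.add_sub_cancel]
      ring
    · refine Finset.sum_congr rfl fun a ha => ?_
      have h1 := Finset.mem_range.1 ha
      rw [if_neg hd.not_gt, Nat.add_sub_cancel_left, Nat.add_sub_add_left,
        show m - a = (m - 1 - a) + 1 by omega,
        show lowDepth h N S + m - 1 - (lowDepth h N S + a) = m - 1 - a by omega]
      ring
  · intro a _ b _ hab
    simpa using hab
  · intro a _ b _ hab
    simpa using hab
  · refine Finset.disjoint_left.2 fun c h1 h2 => ?_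
    simp only [Finset.mem_image, Finset.mem_range] at h1 h2
    obtain ⟨a, ha, rfl⟩ := h1
    obtain ⟨b, hb, h3⟩ := h2
    simp only [Prod.mk.injEq] at h3
    omega

/-- The generating function of the stackings in terms of the states. -/
theorem stackSum_eq_stateSum (hN : ∀ x < N, h (x + 1) = h x + 1 ∨ h (x + 1) = h x - 1)
    (q : A) (x : ℤ → A) :
    stackSum h N q x = stateSum h q N fun s => stateProd q x (h N) 0 (s.1 :: s.2) := by
  -- The ring must vary: the up step uses the induction hypothesis over the polynomial ring.
  induction N generalizing A with
  | zero => simp [stackSum, stackings, stateSum, stateProd, qProd_zero]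
  | succ N ih =>
    replace ih := fun {B : Type _} [CommRing B] (q : B) (x : ℤ → B) =>
      ih (A := B) (fun y hy => hN y (by omega)) q x
    rw [stateSum]
    split_ifs with hd
    · have h1 : h (N + 1) = h N - 1 := by have := hN N (by omega); omega
      rw [stackSum_down hN hd, ih, stateSum_mul_left, h1]
      simp only [stateProd_stateDown]
    · have h1 : h (N + 1) = h N + 1 := by have := hN N (by omega); omega
      rw [stackSum_up hN (by omega), ih, h1]
      refine (map_stateSum h (divDiff q (x (h N)) (q * x (h N + 1))).toAddMonoidHom
        (Polynomial.C q) q (fun k a => ?_) N _).trans ?_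
      · rw [← Polynomial.C_pow]
        exact divDiff_C_mul _ _ _ _ _
      · simp only [LinearMap.toAddMonoidHom_coe, divDiff_stateProd]

theorem stackSum_const (hN : ∀ x < N, h (x + 1) = h x + 1 ∨ h (x + 1) = h x - 1)
    (q t : A) :
    stackSum h N q (fun _ => t) = stateSum h q N (fun _ => 1) * qProd q t (downs h 0 N) := by
  rw [stackSum_eq_stateSum hN, mul_comm, stateSum_mul_left]
  refine stateSum_congr _ _ _ _ _ fun s hs => ?_
  rw [stateProd_const, List.sum_cons, hs]
  simp

end Recursion

/-! ### Heights of paths -/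

section Heights

lemma height_zero (p : List DyckStep) : height p 0 = 0 := by simp [height]

lemma height_of_length_le (p : List DyckStep) {x : ℕ} (hx : p.length ≤ x) :
    height p x = height p p.length := by
  simp [height, List.take_of_length_le hx]

lemma height_append_of_le (p r : List DyckStep) {x : ℕ} (hx : x ≤ p.length) :
    height (p ++ r) x = height p x := by
  simp [height, List.take_append_of_le_length hx]

lemma height_succ (p : List DyckStep) (x : ℕ) :
    height p (x + 1) = height p x +
      if p[x]? = some DyckStep.U then 1 else if p[x]? = some DyckStep.D then -1 else 0 := by
  simp only [height, List.take_add_one, List.count_append]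
  rcases p[x]? with _ | _ | _ <;> simp <;> ring

lemma height_succ_lt_iff (p : List DyckStep) (x : ℕ) :
    height p (x + 1) < height p x ↔ p[x]? = some DyckStep.D := by
  rw [height_succ]
  rcases p[x]? with _ | _ | _ <;> simp

lemma height_succ_eq (p : List DyckStep) {x : ℕ} (hx : x < p.length) :
    height p (x + 1) = height p x + 1 ∨ height p (x + 1) = height p x - 1 := by
  rw [height_succ, List.getElem?_eq_getElem hx]
  rcases p[x] with _ | _ <;> simp
  omega

lemma abs_height_le (p : List DyckStep) (x : ℕ) : -(x : ℤ) ≤ height p x ∧ height p x ≤ x := by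
  induction x with
  | zero => simp [height_zero]
  | succ x ih =>
    rw [height_succ]
    push_cast
    split_ifs <;> omega

lemma even_add_height (p : List DyckStep) {x : ℕ} (hx : x ≤ p.length) :
    Even ((x : ℤ) + height p x) := by
  induction x with
  | zero => simp [height_zero]
  | succ x ih =>
    have := ih (by omega)
    rw [Int.even_iff] at this ⊢
    push_cast
    rcases height_succ_eq p hx with h | h <;> omega

lemma height_take_drop (p : List DyckStep) (i n : ℕ) {x : ℕ} (hx : x ≤ n) :
    height ((p.drop i).take n) x = height p (i + x) - height p i := by
  simp only [height, List.take_take, min_eq_left hx, List.take_add, List.count_append]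
  push_cast
  ring

lemma count_take_drop (p : List DyckStep) {i j : ℕ} (hij : i ≤ j) :
    ((p.drop i).take (j - i)).count DyckStep.D = downs (height p) i j := by
  induction j, hij using Nat.le_induction with
  | base => simp [downs_self]
  | succ j hj ih =>
    rw [Nat.succ_sub hj, List.take_add_one, List.count_append, ih, downs_succ _ hj,
      List.getElem?_drop, Nat.add_sub_cancel' hj]
    simp only [height_succ_lt_iff]
    rcases p[j]? with _ | _ | _ <;> simp

lemma downs_height (p : List DyckStep) :
    downs (height p) 0 p.length = p.count DyckStep.D := by
  rw [← count_take_drop p (Nat.zero_le _)]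
  simp

lemma eq_of_height_eq {p r : List DyckStep} (hl : p.length = r.length)
    (h : ∀ x ≤ p.length, height p x = height r x) : p = r := by
  refine List.ext_getElem hl fun x hp hr => ?_
  have h1 := h (x + 1) hp
  rw [height_succ, height_succ, h x hp.le, List.getElem?_eq_getElem hp,
    List.getElem?_eq_getElem hr] at h1
  generalize p[x] = u at h1 ⊢
  generalize r[x] = v at h1 ⊢
  rcases u with _ | _ <;> rcases v with _ | _ <;> simp at h1 ⊢

lemma exists_height_eq (m : ℕ → ℤ) (h0 : m 0 = 0) (N : ℕ)
    (hm : ∀ x < N, m (x + 1) = m x + 1 ∨ m (x + 1) = m x - 1) :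
    ∃ p : List DyckStep, p.length = N ∧ ∀ x ≤ N, height p x = m x := by
  induction N with
  | zero => exact ⟨[], rfl, fun x hx => by rw [Nat.le_zero.1 hx, height_zero, h0]⟩
  | succ N ih =>
    obtain ⟨p, hp, h⟩ := ih fun x hx => hm x (by omega)
    refine ⟨p ++ [if m (N + 1) = m N + 1 then DyckStep.U else DyckStep.D], by simp [hp],
      fun x hx => ?_⟩
    rcases hx.lt_or_eq with hx | rfl
    · rw [height_append_of_le _ _ (by omega), h x (by omega)]
    · rw [height_succ, height_append_of_le _ _ hp.ge, h N le_rfl,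
        List.getElem?_append_right hp.le, hp, Nat.sub_self]
      rcases hm N (by omega) with h1 | h1
      · simp [h1]
      · have : ¬ m N - 1 = m N + 1 := by omega
        simp [h1, this]
        ring

lemma isBallotPath_iff (p : List DyckStep) :
    IsBallotPath p ↔ ∀ x ≤ p.length, 0 ≤ height p x := by
  refine ⟨fun h x _ => h x, fun h x => ?_⟩
  rcases le_total x p.length with hx | hx
  · exact h x hx
  · rw [height_of_length_le p hx]
    exact h _ le_rfl

lemma isDyckPath_iff (p : List DyckStep) :
    IsDyckPath p ↔ IsBallotPath p ∧ height p p.length = 0 := by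
  constructor
  · rintro ⟨w, rfl⟩
    refine ⟨fun i => ?_, ?_⟩
    · have := w.count_D_le_count_U i
      simp only [height]
      omega
    · have := w.count_U_eq_count_D
      simp only [height, List.take_length]
      omega
  · rintro ⟨h1, h2⟩
    refine ⟨⟨p, ?_, fun i => ?_⟩, rfl⟩
    · simp only [height, List.take_length] at h2
      omega
    · have := h1 i
      simp only [height] at this
      omega

lemma LiesAbove.of_le {mu lam : List DyckStep} (hl : mu.length = lam.length)
    (h : ∀ x ≤ lam.length, height lam x ≤ height mu x) : LiesAbove mu lam := by
  refine ⟨hl, fun x => ?_⟩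
  rcases le_total x lam.length with hx | hx
  · exact h x hx
  · rw [height_of_length_le lam hx, height_of_length_le mu (hl.trans_le hx), hl]
    exact h _ le_rfl

lemma mem_skewShape {mu lam : List DyckStep} {x : ℕ} {y : ℤ} :
    (x, y) ∈ skewShape lam mu ↔ x ≤ lam.length ∧ (∃ k : ℕ, y = height lam x + 1 + 2 * k) ∧
      y < height mu x := by
  simp only [skewShape, Finset.mem_filter, Finset.mem_product, Finset.mem_range, Finset.mem_Icc]
  constructor
  · rintro ⟨⟨hx, -⟩, hodd, h1, h2⟩
    have heven := even_add_height lam (show x ≤ lam.length by omega)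
    rw [Int.even_iff] at heven
    rw [Int.odd_iff] at hodd
    exact ⟨by omega, ⟨((y - height lam x - 1) / 2).toNat, by omega⟩, h2⟩
  · rintro ⟨hx, ⟨k, hk⟩, h2⟩
    have heven := even_add_height lam hx
    rw [Int.even_iff] at heven
    rw [Int.odd_iff]
    have := abs_height_le lam x
    have := abs_height_le mu x
    omega

end Heights

/-! ### The correspondence between tilings and stackings -/

section Tiles

/-- The tile of a tiling over `lam` with the boxes `(x, y)`, where `i ≤ x ≤ j` and
`y = height lam x + 1 + 2 k`. -/
def tileOf (lam : List DyckStep) (τ : ℕ × ℕ × ℕ) : Tile :=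
  ⟨τ.1, height lam τ.1 + 1 + 2 * τ.2.2, (lam.drop τ.1).take (τ.2.1 - τ.1)⟩

variable {lam mu : List DyckStep} {T : Finset Tile} {S : Finset (ℕ × ℕ × ℕ)} {i j k : ℕ}

lemma length_tileOf (hj : j ≤ lam.length) :
    (tileOf lam (i, j, k)).word.length = j - i := by
  simp only [tileOf, List.length_take, List.length_drop]
  omega

lemma lastCol_tileOf (hij : i ≤ j) (hj : j ≤ lam.length) :
    (tileOf lam (i, j, k)).lastCol = j := by
  rw [Tile.lastCol, length_tileOf hj]
  exact Nat.add_sub_cancel' hij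

lemma mem_boxes_tileOf (hij : i ≤ j) (hj : j ≤ lam.length) {x : ℕ} {y : ℤ} :
    (x, y) ∈ (tileOf lam (i, j, k)).boxes ↔
      i ≤ x ∧ x ≤ j ∧ y = height lam x + 1 + 2 * k := by
  rw [Tile.boxes, length_tileOf hj]
  simp only [Finset.mem_image, Finset.mem_range, Prod.mk.injEq, tileOf]
  constructor
  · rintro ⟨l, hl, rfl, rfl⟩
    refine ⟨by omega, by omega, ?_⟩
    rw [height_take_drop _ _ _ (by omega)]
    ring
  · rintro ⟨h1, h2, rfl⟩
    refine ⟨x - i, by omega, by omega, ?_⟩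
    rw [height_take_drop _ _ _ (by omega), Nat.add_sub_cancel' h1]
    ring

lemma tileOf_inj {i' j' k' : ℕ} (hij : i ≤ j) (hj : j ≤ lam.length) (hij' : i' ≤ j')
    (hj' : j' ≤ lam.length) (h : tileOf lam (i, j, k) = tileOf lam (i', j', k')) :
    (i, j, k) = (i', j', k') := by
  have h1 : i = i' := congrArg Tile.col h
  subst h1
  have h2 := congrArg Tile.row h
  have h3 := congrArg Tile.lastCol h
  rw [lastCol_tileOf hij hj, lastCol_tileOf hij' hj'] at h3
  simp only [tileOf] at h2
  obtain rfl : k = k' := by omega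
  rw [h3]

lemma mem_shiftDown {B : Tile} {x : ℕ} {y : ℤ} :
    (x, y) ∈ B.shiftDown ↔ (x, y + 2) ∈ B.boxes := by
  simp only [Tile.shiftDown, Finset.mem_image, Prod.exists, Prod.mk.injEq]
  constructor
  · rintro ⟨x, y', h1, rfl, rfl⟩
    simpa using h1
  · intro h1
    exact ⟨x, y + 2, h1, rfl, by ring⟩

lemma mem_boxes {B : Tile} {l : ℕ} (hl : l ≤ B.word.length) :
    (B.col + l, B.row + height B.word l) ∈ B.boxes :=
  Finset.mem_image.2 ⟨l, by rw [Finset.mem_range]; omega, rfl⟩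

lemma halfLength_tileOf (hij : i ≤ j) :
    (tileOf lam (i, j, k)).halfLength = downs (height lam) i j :=
  count_take_drop lam hij

lemma art_tileOf (hij : i ≤ j) (hj : j ≤ lam.length) :
    (tileOf lam (i, j, k)).art lam.length =
      downs (height lam) i j + if j = lam.length then 0 else 1 := by
  rw [Tile.art, lastCol_tileOf hij hj, Tile.area, Tile.tiles, halfLength_tileOf hij]
  split_ifs <;> omega

namespace IsCoverInclusiveTiling

variable {P : Tile → Prop}

lemma boxes_subset (hT : IsCoverInclusiveTiling P lam mu T) {B : Tile} (hB : B ∈ T) :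
    B.boxes ⊆ skewShape lam mu := by
  rw [← hT.cover]
  exact Finset.subset_biUnion_of_mem _ hB

lemma lastCol_le (hT : IsCoverInclusiveTiling P lam mu T) {B : Tile} (hB : B ∈ T) :
    B.lastCol ≤ lam.length :=
  (mem_skewShape.1 (hT.boxes_subset hB (mem_boxes le_rfl))).1

/-- All the boxes of a tile have the same distance from the lower path. -/
lemma level_const (hT : IsCoverInclusiveTiling P lam mu T) (k : ℕ) {B : Tile} (hB : B ∈ T)
    {x x' : ℕ} {y y' : ℤ} (hx : (x, y) ∈ B.boxes) (hx' : (x', y') ∈ B.boxes)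
    (hy : y = height lam x + 1 + 2 * k) : y' = height lam x' + 1 + 2 * k := by
  induction k generalizing B x x' y y' with
  | zero =>
    -- A box on the lowest level leaves the shape when shifted down, so the shifted tile fits in no
    -- other tile; it lies wholly below `lam`, and every box was on the lowest level.
    rcases hT.coverInclusive B hB with h | ⟨C, hC, -, h⟩
    · obtain ⟨-, ⟨l, hl⟩, -⟩ := mem_skewShape.1 (hT.boxes_subset hB hx')
      have := h (x', y' - 2) (mem_shiftDown.2 (by simpa using hx'))
      dsimp only at this
      push_cast
      omega
    · obtain ⟨-, ⟨l, hl⟩, -⟩ := mem_skewShape.1 (hT.boxes_subset hC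
        (h (mem_shiftDown.2 (show (x, y - 2 + 2) ∈ B.boxes by simpa using hx))))
      push_cast at hy
      omega
  | succ k ih =>
    -- Here the shifted box is still above `lam`, so the shifted tile lies in a tile one level
    -- lower.
    rcases hT.coverInclusive B hB with h | ⟨C, hC, -, h⟩
    · have := h (x, y - 2) (mem_shiftDown.2 (by simpa using hx))
      dsimp only at this
      push_cast at hy
      omega
    · have := ih hC (h (mem_shiftDown.2 (show (x, y - 2 + 2) ∈ B.boxes by simpa using hx)))
        (h (mem_shiftDown.2 (show (x', y' - 2 + 2) ∈ B.boxes by simpa using hx')))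
        (by push_cast at hy; omega)
      push_cast
      omega

lemma exists_eq_tileOf (hT : IsCoverInclusiveTiling P lam mu T) {B : Tile} (hB : B ∈ T) :
    ∃ k, B = tileOf lam (B.col, B.lastCol, k) := by
  have h0 := mem_boxes (Nat.zero_le B.word.length)
  obtain ⟨-, ⟨k, hk⟩, -⟩ := mem_skewShape.1 (hT.boxes_subset hB h0)
  have hle := hT.lastCol_le hB
  have hall := fun l (hl : l ≤ B.word.length) =>
    hT.level_const k hB h0 (mem_boxes hl) hk
  rw [height_zero] at hk
  refine ⟨k, ?_⟩
  obtain ⟨c, r, w⟩ := B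
  simp only [add_zero] at hk hall
  simp only [tileOf, Tile.lastCol, Nat.add_sub_cancel_left, Tile.mk.injEq, true_and] at hle ⊢
  refine ⟨hk, eq_of_height_eq (by simp; omega) fun x hx => ?_⟩
  rw [height_take_drop _ _ _ hx]
  have := hall x hx
  omega

end IsCoverInclusiveTiling

/-- The stacking of a tiling. -/
def stackOf (lam : List DyckStep) (T : Finset Tile) : Finset (ℕ × ℕ × ℕ) :=
  T.image fun B => (B.col, B.lastCol, ((B.row - height lam B.col - 1) / 2).toNat)

open Classical in
/-- The tiles of a stacking. -/
noncomputable def tilesOf (lam : List DyckStep) (S : Finset (ℕ × ℕ × ℕ)) : Finset Tile :=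
  S.image (tileOf lam)

lemma IsCoverInclusiveTiling.mem_stackOf {P : Tile → Prop}
    (hT : IsCoverInclusiveTiling P lam mu T) :
    (i, j, k) ∈ stackOf lam T ↔ i ≤ j ∧ j ≤ lam.length ∧ tileOf lam (i, j, k) ∈ T := by
  simp only [stackOf, Finset.mem_image, Prod.mk.injEq]
  constructor
  · rintro ⟨B, hB, rfl, rfl, rfl⟩
    refine ⟨Nat.le_add_right _ _, hT.lastCol_le hB, ?_⟩
    obtain ⟨k, hk⟩ := hT.exists_eq_tileOf hB
    have h1 : B.row = height lam B.col + 1 + 2 * k := congrArg Tile.row hk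
    rw [h1, show ((height lam B.col + 1 + 2 * (k : ℤ) - height lam B.col - 1) / 2).toNat = k by
      omega, ← hk]
    exact hB
  · rintro ⟨h1, h2, h3⟩
    refine ⟨_, h3, rfl, lastCol_tileOf h1 h2, ?_⟩
    simp only [tileOf]
    omega

lemma IsCoverInclusiveTiling.tilesOf_stackOf {P : Tile → Prop}
    (hT : IsCoverInclusiveTiling P lam mu T) : tilesOf lam (stackOf lam T) = T := by
  ext B
  simp only [tilesOf, Finset.mem_image, Prod.exists, hT.mem_stackOf]
  constructor
  · rintro ⟨i, j, k, ⟨-, -, h⟩, rfl⟩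
    exact h
  · intro hB
    obtain ⟨k, hk⟩ := hT.exists_eq_tileOf hB
    exact ⟨_, _, k, ⟨Nat.le_add_right _ _, hT.lastCol_le hB, hk ▸ hB⟩, hk.symm⟩

lemma IsCoverInclusiveTiling.covers_stackOf {P : Tile → Prop}
    (hT : IsCoverInclusiveTiling P lam mu T) {x : ℕ} :
    Covers (stackOf lam T) x k ↔
      x ≤ lam.length ∧ height lam x + 1 + 2 * (k : ℤ) < height mu x := by
  have h1 : (x, height lam x + 1 + 2 * (k : ℤ)) ∈ skewShape lam mu ↔
      x ≤ lam.length ∧ height lam x + 1 + 2 * (k : ℤ) < height mu x := by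
    rw [mem_skewShape]
    exact ⟨fun h => ⟨h.1, h.2.2⟩, fun h => ⟨h.1, ⟨k, rfl⟩, h.2⟩⟩
  rw [← h1, ← hT.cover, Finset.mem_biUnion]
  constructor
  · rintro ⟨i, j, h2, h3, h4⟩
    obtain ⟨h5, h6, h7⟩ := hT.mem_stackOf.1 h2
    exact ⟨_, h7, (mem_boxes_tileOf h5 h6).2 ⟨h3, h4, rfl⟩⟩
  · rintro ⟨B, hB, hx⟩
    obtain ⟨l, hl⟩ := hT.exists_eq_tileOf hB
    have h2 : B.col ≤ B.lastCol := Nat.le_add_right _ _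
    have h3 := hT.lastCol_le hB
    rw [hl, mem_boxes_tileOf h2 h3] at hx
    obtain rfl : k = l := by omega
    exact ⟨B.col, B.lastCol, hT.mem_stackOf.2 ⟨h2, h3, hl ▸ hB⟩, hx.1, hx.2.1⟩

lemma IsCoverInclusiveTiling.isStacking (hmu : LiesAbove mu lam)
    (hT : IsCoverInclusiveTiling (Tile.IsBallot lam.length) lam mu T) :
    IsStacking (height lam) lam.length (stackOf lam T) where
  le i j k h1 := by
    have := hT.mem_stackOf.1 h1
    exact ⟨this.1, this.2.1⟩
  ballot i j k h1 x hix hxj := by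
    obtain ⟨h1, h2, h3⟩ := hT.mem_stackOf.1 h1
    have h4 := (hT.tile _ h3).1 (x - i)
    simp only [tileOf] at h4
    rw [height_take_drop _ _ _ (by omega), Nat.add_sub_cancel' hix] at h4
    omega
  closed i j k h1 hj := by
    obtain ⟨h1, h2, h3⟩ := hT.mem_stackOf.1 h1
    have h4 := (hT.tile _ h3).1 (j - i)
    have h5 := (hT.tile _ h3).2
    rw [length_tileOf h2, lastCol_tileOf h1 h2] at h5
    simp only [tileOf] at h4 h5
    rw [height_take_drop _ _ _ le_rfl, Nat.add_sub_cancel' h1] at h4 h5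
    omega
  unique i j i' j' k x h1 h2 hix hxj hix' hxj' := by
    obtain ⟨h1, h3, h4⟩ := hT.mem_stackOf.1 h1
    obtain ⟨h2, h5, h6⟩ := hT.mem_stackOf.1 h2
    by_contra hne
    have hne' : tileOf lam (i, j, k) ≠ tileOf lam (i', j', k) := fun h => by
      have := tileOf_inj h1 h3 h2 h5 h
      simp only [Prod.mk.injEq] at this
      exact hne ⟨this.1, this.2.1⟩
    exact Finset.disjoint_left.1 (hT.disjoint _ h4 _ h6 hne')
      ((mem_boxes_tileOf h1 h3).2 ⟨hix, hxj, rfl⟩) ((mem_boxes_tileOf h2 h5).2 ⟨hix', hxj', rfl⟩)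
  nested i j k h1 := by
    obtain ⟨h1, h2, h3⟩ := hT.mem_stackOf.1 h1
    have hbox : ∀ x, i ≤ x → x ≤ j →
        (x, height lam x + 1 + 2 * (k : ℤ)) ∈ (tileOf lam (i, j, k + 1)).shiftDown := by
      intro x hix hxj
      rw [mem_shiftDown, mem_boxes_tileOf h1 h2]
      exact ⟨hix, hxj, by push_cast; ring⟩
    rcases hT.coverInclusive _ h3 with h | ⟨C, hC, -, h⟩
    · have := h _ (hbox i le_rfl h1)
      dsimp only at this
      omega
    · obtain ⟨l, hl⟩ := hT.exists_eq_tileOf hC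
      have h4 : C.col ≤ C.lastCol := Nat.le_add_right _ _
      have h5 := hT.lastCol_le hC
      rw [hl] at h
      have h6 := (mem_boxes_tileOf h4 h5).1 (h (hbox i le_rfl h1))
      have h7 := (mem_boxes_tileOf h4 h5).1 (h (hbox j h1 le_rfl))
      obtain rfl : k = l := by omega
      exact ⟨C.col, C.lastCol, hT.mem_stackOf.2 ⟨h4, h5, hl ▸ hC⟩, h6.1, h7.2.1⟩
  not_covers_zero k := by
    rw [hT.covers_stackOf, height_zero, height_zero]
    omega
  down x k hx hd := by
    have h1 := height_succ_eq lam hx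
    have h2 := height_succ_eq mu (hx.trans_eq hmu.1.symm)
    rw [hT.covers_stackOf, hT.covers_stackOf]
    omega
  down' x k hx hd := by
    have h1 := height_succ_eq lam hx
    have h2 := height_succ_eq mu (hx.trans_eq hmu.1.symm)
    rw [hT.covers_stackOf, hT.covers_stackOf]
    push_cast
    omega
  up x k hx hd := by
    have h1 := height_succ_eq lam hx
    have h2 := height_succ_eq mu (hx.trans_eq hmu.1.symm)
    rw [hT.covers_stackOf, hT.covers_stackOf]
    omega
  up' x k hx hd := by
    have h1 := height_succ_eq lam hx
    have h2 := height_succ_eq mu (hx.trans_eq hmu.1.symm)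
    rw [hT.covers_stackOf, hT.covers_stackOf]
    push_cast
    omega

lemma IsStacking.covers_iff_lt_card {h : ℕ → ℤ} {N : ℕ} (hS : IsStacking h N S) (x k : ℕ) :
    Covers S x k ↔
      k < ((S.filter fun τ => τ.1 ≤ x ∧ x ≤ τ.2.1).image fun τ => τ.2.2).card := by
  rw [← mem_iff_lt_card]
  · simp [Covers]
  · intro k
    simp only [Finset.mem_image, Finset.mem_filter, Prod.exists]
    rintro ⟨i, j, _, ⟨h1, h2, h3⟩, rfl⟩
    obtain ⟨i', j', h4, h5, h6⟩ := hS.nested _ _ _ h1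
    exact ⟨i', j', k, ⟨h4, h5.trans h2, h3.trans h6⟩, rfl⟩

lemma IsStacking.exists_isCoverInclusiveTiling (hS : IsStacking (height lam) lam.length S) :
    ∃ mu, LiesAbove mu lam ∧
      IsCoverInclusiveTiling (Tile.IsBallot lam.length) lam mu (tilesOf lam S) := by
  -- `d x` counts the covered levels over x, and each level has height 2; so the upper path has to
  -- be `lam` raised by `2 * d x`.
  obtain ⟨d, hd⟩ : ∃ d : ℕ → ℕ, ∀ x k, Covers S x k ↔ k < d x :=
    ⟨_, hS.covers_iff_lt_card⟩
  obtain ⟨mu, hlen, hmu⟩ := exists_height_eq (fun x => height lam x + 2 * d x) (by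
    have h0 : ¬ 0 < d 0 := fun h => hS.not_covers_zero 0 ((hd 0 0).2 h)
    simp only [height_zero]
    omega) lam.length (fun x hx => by
      have h1 := height_succ_eq lam hx
      have hdown := fun k => hS.down x k hx
      have hdown' := fun k => hS.down' x k hx
      have hup := fun k => hS.up x k hx
      have hup' := fun k => hS.up' x k hx
      simp only [hd] at hdown hdown' hup hup'
      rcases h1 with h1 | h1
      · have h2 := hup (d x) (by omega)
        have h3 := hup' (d (x + 1)) (by omega)
        rw [h1]
        omega
      · have h2 := hdown (d (x + 1)) (by omega)
        have h3 := hdown' (d x) (by omega)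
        rw [h1]
        omega)
  refine ⟨mu, .of_le hlen fun x hx => by rw [hmu x hx]; omega, ?_, ?_, ?_, ?_⟩
  · simp only [tilesOf, Finset.mem_image, Prod.exists]
    rintro _ ⟨i, j, k, h1, rfl⟩
    have h2 := hS.le _ _ _ h1
    refine ⟨(isBallotPath_iff _).2 fun x hx => ?_, fun h3 => ?_⟩
    · rw [length_tileOf h2.2] at hx
      rw [tileOf, height_take_drop _ _ _ hx]
      have := hS.ballot _ _ _ h1 (i + x) (by omega) (by omega)
      dsimp only
      omega
    · rw [length_tileOf h2.2, tileOf, height_take_drop _ _ _ le_rfl] at h3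
      dsimp only at h3
      rw [Nat.add_sub_cancel' h2.1] at h3
      rw [lastCol_tileOf h2.1 h2.2]
      by_contra h4
      have := hS.closed _ _ _ h1 (by omega)
      omega
  · simp only [tilesOf, Finset.mem_image, Prod.exists]
    rintro _ ⟨i, j, k, h1, rfl⟩ _ ⟨i', j', k', h2, rfl⟩ hne
    have h3 := hS.le _ _ _ h1
    have h4 := hS.le _ _ _ h2
    refine Finset.disjoint_left.2 ?_
    rintro ⟨x, y⟩ hx hx'
    rw [mem_boxes_tileOf h3.1 h3.2] at hx
    rw [mem_boxes_tileOf h4.1 h4.2] at hx'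
    obtain rfl : k = k' := by omega
    obtain ⟨rfl, rfl⟩ := hS.unique _ _ _ _ _ x h1 h2 hx.1 hx.2.1 hx'.1 hx'.2.1
    exact hne rfl
  · ext ⟨x, y⟩
    simp only [tilesOf, Finset.mem_biUnion, Finset.mem_image, Prod.exists, mem_skewShape]
    constructor
    · rintro ⟨_, ⟨i, j, k, h1, rfl⟩, hx⟩
      have h2 := hS.le _ _ _ h1
      rw [mem_boxes_tileOf h2.1 h2.2] at hx
      have h3 := (hd x k).1 ⟨i, j, h1, hx.1, hx.2.1⟩
      refine ⟨by omega, ⟨k, hx.2.2⟩, ?_⟩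
      rw [hmu x (by omega)]
      omega
    · rintro ⟨hx, ⟨k, rfl⟩, h1⟩
      rw [hmu x hx] at h1
      obtain ⟨i, j, h2, h3, h4⟩ := (hd x k).2 (by omega)
      have h5 := hS.le _ _ _ h2
      exact ⟨_, ⟨i, j, k, h2, rfl⟩, (mem_boxes_tileOf h5.1 h5.2).2 ⟨h3, h4, rfl⟩⟩
  · simp only [tilesOf, Finset.mem_image, Prod.exists]
    rintro _ ⟨i, j, k, h1, rfl⟩
    have h2 := hS.le _ _ _ h1
    rcases k with _ | k
    · left
      rintro ⟨x, y⟩ hx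
      rw [mem_shiftDown, mem_boxes_tileOf h2.1 h2.2] at hx
      push_cast at hx
      dsimp only
      omega
    · right
      obtain ⟨i', j', h3, h4, h5⟩ := hS.nested _ _ _ h1
      have h6 := hS.le _ _ _ h3
      refine ⟨_, ⟨i', j', k, h3, rfl⟩, fun h => ?_, ?_⟩
      · have := tileOf_inj h6.1 h6.2 h2.1 h2.2 h
        simp at this
      · rintro ⟨x, y⟩ hx
        rw [mem_shiftDown, mem_boxes_tileOf h2.1 h2.2] at hx
        rw [mem_boxes_tileOf h6.1 h6.2]
        push_cast at hx
        omega

lemma IsStacking.stackOf_tilesOf (hS : IsStacking (height lam) lam.length S) :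
    stackOf lam (tilesOf lam S) = S := by
  obtain ⟨mu, -, hT⟩ := hS.exists_isCoverInclusiveTiling
  ext ⟨i, j, k⟩
  rw [hT.mem_stackOf]
  simp only [tilesOf, Finset.mem_image, Prod.exists]
  constructor
  · rintro ⟨h1, h2, i', j', k', h3, h4⟩
    have h5 := hS.le _ _ _ h3
    rw [← tileOf_inj h5.1 h5.2 h1 h2 h4]
    exact h3
  · intro h1
    have h2 := hS.le _ _ _ h1
    exact ⟨h2.1, h2.2, i, j, k, h1, rfl⟩

lemma IsStacking.prod_tilesOf {A : Type*} [CommRing A]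
    (hS : IsStacking (height lam) lam.length S) (q t : A) :
    q ^ ballotArt lam.length (tilesOf lam S) * t ^ tilesTwo lam.length (tilesOf lam S) =
      ∏ τ ∈ S, tileWeight (height lam) lam.length q (fun _ => t) τ := by
  rw [ballotArt, tilesTwo, ← Finset.prod_pow_eq_pow_sum, ← Finset.prod_const,
    Finset.prod_filter, ← Finset.prod_mul_distrib, tilesOf]
  classical
  rw [Finset.prod_image]
  · refine Finset.prod_congr rfl ?_
    rintro ⟨i, j, k⟩ hτ
    have h1 := hS.le _ _ _ hτ
    rw [art_tileOf h1.1 h1.2, lastCol_tileOf h1.1 h1.2, tileWeight]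
    split_ifs <;> simp [pow_succ]
  · rintro ⟨i, j, k⟩ h1 ⟨i', j', k'⟩ h2 heq
    have h3 := hS.le _ _ _ h1
    have h4 := hS.le _ _ _ h2
    exact tileOf_inj h3.1 h3.2 h4.1 h4.2 heq

/-- The type BIII generating function in terms of stackings. -/
theorem genBIII_eq_stackSum {A : Type*} [CommRing A] (q t : A) (lam : List DyckStep) :
    genBIII q t lam = stackSum (height lam) lam.length q fun _ => t := by
  have hstep : ∀ x < lam.length, height lam (x + 1) = height lam x + 1 ∨
      height lam (x + 1) = height lam x - 1 := fun x hx => height_succ_eq lam hx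
  simp only [genBIII, genBIIIPair, stackSum]
  rw [Finset.sum_sigma']
  have hmem : ∀ p ∈ (upperPaths lam).sigma (ballotTilings lam), LiesAbove p.1 lam ∧
      IsCoverInclusiveTiling (Tile.IsBallot lam.length) lam p.1 p.2 := by
    rintro ⟨mu, T⟩ hp
    simpa [upperPaths, ballotTilings] using hp
  refine Finset.sum_bij (fun p _ => stackOf lam p.2) ?_ ?_ ?_ ?_
  · intro p hp
    obtain ⟨h1, h2⟩ := hmem p hp
    exact (mem_stackings hstep).2 (h2.isStacking h1)
  · rintro ⟨mu, T⟩ hp ⟨mu', T'⟩ hp' heq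
    obtain ⟨h1, h2⟩ := hmem _ hp
    obtain ⟨h3, h4⟩ := hmem _ hp'
    dsimp only at h1 h2 h3 h4 heq
    have h5 : T = T' := by rw [← h2.tilesOf_stackOf, heq, h4.tilesOf_stackOf]
    subst h5
    have h6 : mu = mu' := by
      refine eq_of_height_eq (h1.1.trans h3.1.symm) fun x hx => ?_
      have hx' := hx.trans_eq h1.1
      have h7 := even_add_height lam hx'
      have h8 := even_add_height mu hx
      have h9 := even_add_height mu' (hx'.trans_eq h3.1.symm)
      rw [Int.even_iff] at h7 h8 h9
      have h10 := h1.2 x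
      have h11 := h3.2 x
      have h12 : ∀ k : ℕ, (x ≤ lam.length ∧ height lam x + 1 + 2 * (k : ℤ) < height mu x) ↔
          (x ≤ lam.length ∧ height lam x + 1 + 2 * (k : ℤ) < height mu' x) := fun k => by
        rw [← h2.covers_stackOf, ← h4.covers_stackOf]
      -- This is the first uncovered level under `mu`. Testing it, and the one for `mu'`, bounds
      -- each path by the other, up to parity.
      have h13 := h12 ((height mu x - height lam x) / 2).toNat
      have h14 := h12 ((height mu' x - height lam x) / 2).toNat
      omega
    rw [h6]
  · intro S hS
    have hS := (mem_stackings hstep).1 hS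
    obtain ⟨mu, h1, h2⟩ := hS.exists_isCoverInclusiveTiling
    exact ⟨⟨mu, tilesOf lam S⟩, by simp [upperPaths, ballotTilings, h1, h2], hS.stackOf_tilesOf⟩
  · intro p hp
    obtain ⟨h1, h2⟩ := hmem p hp
    rw [← (h2.isStacking h1).prod_tilesOf, h2.tilesOf_stackOf]

end Tiles

/-! ### Dyck tilings as the specialization t = 0 -/

section DyckTilings

variable {lam mu : List DyckStep} {T : Finset Tile}

lemma Tile.card_boxes (B : Tile) : B.boxes.card = B.word.length + 1 := by
  rw [Tile.boxes, Finset.card_image_of_injOn, Finset.card_range]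
  intro i _ j _ hij
  simp only [Prod.mk.injEq] at hij
  omega

lemma IsDyckPath.length_eq {p : List DyckStep} (hp : IsDyckPath p) :
    p.length = 2 * p.count DyckStep.D := by
  obtain ⟨w, rfl⟩ := hp
  have h1 := w.count_U_eq_count_D
  have h2 : ∀ l : List DyckStep, l.length = l.count DyckStep.U + l.count DyckStep.D := by
    intro l
    induction l with
    | nil => rfl
    | cons s l ih => cases s <;> simp [ih] <;> omega
  have := h2 w.toList
  omega

lemma IsDyckPath.of_liesAbove (hlam : IsDyckPath lam) (h : LiesAbove mu lam)
    (hend : height mu lam.length = height lam lam.length) : IsDyckPath mu := by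
  rw [isDyckPath_iff] at hlam ⊢
  exact ⟨fun x => (hlam.1 x).trans (h.2 x), by rw [h.1, hend, hlam.2]⟩

lemma IsCoverInclusiveTiling.lastCol_ne {P : Tile → Prop}
    (hT : IsCoverInclusiveTiling P lam mu T)
    (hend : height mu lam.length = height lam lam.length) {B : Tile} (hB : B ∈ T) :
    B.lastCol ≠ lam.length := by
  intro h
  obtain ⟨-, ⟨k, hk⟩, h1⟩ := mem_skewShape.1 (hT.boxes_subset hB (mem_boxes le_rfl))
  rw [show B.col + B.word.length = lam.length from h] at hk h1
  omega

/-- With equal end points there are no anchor boxes, so no ballot tile can have n' ≥ 1. -/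
lemma isCoverInclusiveTiling_dyck_iff (hend : height mu lam.length = height lam lam.length) :
    IsCoverInclusiveTiling Tile.IsDyck lam mu T ↔
      IsCoverInclusiveTiling (Tile.IsBallot lam.length) lam mu T := by
  constructor
  · intro hT
    refine ⟨fun B hB => ?_, hT.disjoint, hT.cover, hT.coverInclusive⟩
    have := (isDyckPath_iff _).1 (hT.tile B hB)
    exact ⟨this.1, fun h => by omega⟩
  · intro hT
    refine ⟨fun B hB => (isDyckPath_iff _).2 ?_, hT.disjoint, hT.cover, hT.coverInclusive⟩
    have h1 := hT.tile B hB
    have h2 := h1.1 B.word.length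
    have h3 := hT.lastCol_ne hend hB
    have h4 := h1.2
    exact ⟨h1.1, by by_contra h; exact h3 (h4 (by omega))⟩

/-- Each Dyck tile has 2n + 1 boxes and none is anchored, so it contributes (2n + 1 + 1)/2 = n + 1
on both sides. -/
lemma IsCoverInclusiveTiling.dyckArt_eq (hT : IsCoverInclusiveTiling Tile.IsDyck lam mu T)
    (hend : height mu lam.length = height lam lam.length) :
    dyckArt lam mu T = ballotArt lam.length T := by
  have h1 : (skewShape lam mu).card = ∑ B ∈ T, B.boxes.card := by
    rw [← hT.cover, Finset.card_biUnion]
    exact fun B hB C hC hne => hT.disjoint B hB C hC hne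
  have h2 : (skewShape lam mu).card + T.card = 2 * ballotArt lam.length T := by
    rw [h1, ballotArt, Finset.card_eq_sum_ones, ← Finset.sum_add_distrib, Finset.mul_sum]
    refine Finset.sum_congr rfl fun B hB => ?_
    rw [Tile.card_boxes, IsDyckPath.length_eq (hT.tile B hB), Tile.art,
      if_neg (hT.lastCol_ne hend hB), Tile.area, Tile.tiles, Tile.halfLength]
    omega
  rw [dyckArt, h2]
  omega

/-- For a Dyck path, the tilings counted by the type BIII generating function at `t = 0` are the
Dyck tilings. -/
theorem genDyck_eq_genBIII {A : Type*} [CommRing A] (q : A) (hlam : IsDyckPath lam) :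
    genDyck q lam = genBIII q 0 lam := by
  have hlam' := (isDyckPath_iff lam).1 hlam
  rw [genDyck, genBIII]
  have hsub : upperDyckPaths lam ⊆ upperPaths lam := fun mu hmu => by
    simp only [upperDyckPaths, upperPaths, Set.Finite.mem_toFinset, Set.mem_ofPred_eq] at hmu ⊢
    exact ⟨trivial, hmu.2⟩
  rw [← Finset.sum_subset hsub]
  · refine Finset.sum_congr rfl fun mu hmu => ?_
    simp only [upperDyckPaths, Set.Finite.mem_toFinset, Set.mem_ofPred_eq] at hmu
    have hend : height mu lam.length = height lam lam.length := by
      rw [hlam'.2, ← hmu.2.1]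
      exact ((isDyckPath_iff mu).1 hmu.1).2
    rw [genBIIIPair]
    refine Finset.sum_congr ?_ fun T hT => ?_
    · ext T
      simp only [dyckTilings, ballotTilings, Set.Finite.mem_toFinset, Set.mem_ofPred_eq]
      exact isCoverInclusiveTiling_dyck_iff hend
    · simp only [ballotTilings, Set.Finite.mem_toFinset, Set.mem_ofPred_eq] at hT
      rw [((isCoverInclusiveTiling_dyck_iff hend).2 hT).dyckArt_eq hend, tilesTwo,
        Finset.filter_false_of_mem fun B hB => hT.lastCol_ne hend hB]
      simp
  · intro mu hmu hmu'
    simp only [upperDyckPaths, upperPaths, Set.Finite.mem_toFinset, Set.mem_ofPred_eq,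
      true_and] at hmu hmu'
    -- An upper path that is not Dyck ends strictly above `lam`. The shape then has an anchor box,
    -- the tile covering it is counted by `tilesTwo`, and the term contains a positive power of 0.
    refine Finset.sum_eq_zero fun T hT => ?_
    simp only [ballotTilings, Set.Finite.mem_toFinset, Set.mem_ofPred_eq] at hT
    have hend : height mu lam.length ≠ height lam lam.length := fun h =>
      hmu' ⟨hlam.of_liesAbove hmu h, hmu⟩
    have h1 := even_add_height lam le_rfl
    have h2 := even_add_height mu hmu.1.ge
    rw [Int.even_iff] at h1 h2
    have h3 := hmu.2 lam.length
    have h4 : (lam.length, height lam lam.length + 1) ∈ skewShape lam mu :=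
      mem_skewShape.2 ⟨le_rfl, ⟨0, by simp⟩, by omega⟩
    rw [← hT.cover, Finset.mem_biUnion] at h4
    obtain ⟨B, hB, h5⟩ := h4
    have h6 : B.lastCol = lam.length := by
      refine le_antisymm (hT.lastCol_le hB) ?_
      simp only [Tile.boxes, Finset.mem_image, Finset.mem_range, Prod.mk.injEq] at h5
      obtain ⟨i, h7, h8, -⟩ := h5
      rw [Tile.lastCol]
      omega
    have h7 : tilesTwo lam.length T ≠ 0 :=
      Finset.card_ne_zero_of_mem (Finset.mem_filter.2 ⟨hB, h6⟩)
    rw [zero_pow h7, mul_zero]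

end DyckTilings

/-! ### Invariance under added up steps and down steps -/

section Extension

variable {A : Type*} [CommRing A]

/-- An exponent 0 splits only as 0 + 0, with coefficient 1. -/
lemma stateSum_replicate (h : ℕ → ℤ) (q : A) (a : ℕ) (ha : ∀ x < a, ¬ h (x + 1) < h x)
    (g : ℕ × List ℕ → A) : stateSum h q a g = g (0, List.replicate a 0) := by
  induction a generalizing g with
  | zero => rfl
  | succ a ih =>
    rw [stateSum, if_neg (ha a (by omega)), ih fun x hx => ha x (by omega)]
    simp [List.replicate_succ]

/-- Up steps on the left of a path do not change the state functionals which ignore the zeros at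
the end of a state. -/
lemma stateSum_add_left (h h' : ℕ → ℤ) (q : A) (a N : ℕ) (ha : ∀ x < a, ¬ h' (x + 1) < h' x)
    (hN : ∀ x < N, h' (a + x + 1) < h' (a + x) ↔ h (x + 1) < h x) (g : ℕ × List ℕ → A)
    (hg : ∀ c n s, g (n, s ++ List.replicate c 0) = g (n, s)) :
    stateSum h' q (a + N) g = stateSum h q N g := by
  induction N generalizing g with
  | zero =>
    rw [add_zero, stateSum_replicate h' q a ha]
    exact hg a 0 []
  | succ N ih =>
    replace ih := ih fun x hx => hN x (by omega)
    rw [← add_assoc, stateSum, stateSum]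
    simp only [hN N (by omega)]
    -- Insensitivity to trailing zeros passes to the functional pulled back along either kind of
    -- step; a down step may absorb one of these zeros.
    split_ifs with hd
    · refine ih _ fun c n s => ?_
      rcases s with _ | ⟨m, s⟩
      · rcases c with _ | c
        · rfl
        · exact hg c (n + 1) []
      · exact hg c (n + m + 1) s
    · exact ih _ fun c n s => Finset.sum_congr rfl fun k _ => by
        rw [← List.cons_append, hg]

/-- Down steps on the right of a path do not change the number attached to it. -/
lemma stateSum_add_right (h h' : ℕ → ℤ) (q : A) (N b : ℕ)
    (hN : ∀ x < N, h' (x + 1) < h' x ↔ h (x + 1) < h x)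
    (hb : ∀ x < b, h' (N + x + 1) < h' (N + x)) :
    stateSum h' q (N + b) (fun _ => 1) = stateSum h q N fun _ => 1 := by
  induction b with
  | zero =>
    -- With no added steps, the preceding lemma at a = 0 serves only to replace h' by h, whose down
    -- steps agree.
    simpa using stateSum_add_left h h' q 0 N (by simp) (by simpa using hN) (fun _ => 1)
      (fun _ _ _ => rfl)
  | succ b ih =>
    rw [← add_assoc, stateSum, if_pos (hb b (by omega)), ih fun x hx => hb x (by omega)]

lemma stateSum_extend (q : A) (a b : ℕ) (lam : List DyckStep) :
    stateSum (height (extend a b lam)) q (extend a b lam).length (fun _ => 1) =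
      stateSum (height lam) q lam.length fun _ => 1 := by
  have hlen : (extend a b lam).length = a + lam.length + b := by simp [extend]; ring
  rw [hlen, stateSum_add_right (height (List.replicate a DyckStep.U ++ lam)),
    stateSum_add_left (height lam)]
  · intro x hx
    rw [height_succ_lt_iff, List.getElem?_append_left (by simpa using hx)]
    simp [List.getElem?_replicate]
  · intro x hx
    rw [height_succ_lt_iff, height_succ_lt_iff, List.getElem?_append_right (by simp)]
    simp
  · exact fun _ _ _ => rfl
  · intro x hx
    rw [height_succ_lt_iff, height_succ_lt_iff, extend,
      List.getElem?_append_left (by simpa using hx)]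
  · intro x hx
    rw [height_succ_lt_iff, extend, List.getElem?_append_right (by simp)]
    simp [hx]

end Extension

end BallotTiling

theorem mainTheorem3 {R : Type*} [CommRing R] (q t : R) (lam : List DyckStep) (a b : ℕ)
    (hab : BallotTiling.IsDyckPath (BallotTiling.extend a b lam)) :
    BallotTiling.genBIII q t lam =
      BallotTiling.genDyck q (BallotTiling.extend a b lam) *
        ∏ i ∈ Finset.Icc 1 (lam.count DyckStep.D), (1 + q ^ (i - 1) * t) := by
  rw [BallotTiling.genDyck_eq_genBIII q hab, BallotTiling.genBIII_eq_stackSum,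
    BallotTiling.genBIII_eq_stackSum,
    BallotTiling.stackSum_const fun x hx => BallotTiling.height_succ_eq _ hx,
    BallotTiling.stackSum_const fun x hx => BallotTiling.height_succ_eq _ hx,
    BallotTiling.stateSum_extend, BallotTiling.downs_height, BallotTiling.prod_Icc_eq_qProd,
    BallotTiling.qProd_of_zero, mul_one]
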